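/- **Equivariant Cross-Sectioning Theorem.** Let $0\le k\le n$ and let the torus $T^k=(S^1)^k$ act smoothly on a smooth, closed (compact, without boundary) $n$-dimensional manifold $M^n$ such that the orbit space $M^*=M^n/T^k$, with the quotient topology, is homeomorphic to the closed $(n-k)$-dimensional disk $D^{n-k}$. For $x\in M$ let $G_x=\{g\in T^k: gx=x\}$ be its isotropy group. The orbit of $x$ is called principal if $G_x$ is the smallest possible isotropy group, i.e. $G_x\subseteq G_y$ for every $y\in M$, and singular if $\dim G_x$ is strictly larger than the dimension of the principal isotropy group. Suppose that all interior points of the disk $M^*$ are principal orbits, and that all points of the boundary $\partial M^*$ are singular orbits with connected isotropy groups. Then the orbit map $\pi: M^n\to M^*$ has a cross-section, that is, there is a continuous map $s: M^*\to M^n$ with $\pi\circ s=\mathrm{id}_{M^*}$. -/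

import Mathlib

open scoped Manifold ContDiff

/-- The `k`-dimensional torus `T^k`, the `k`-fold product of the unit circle. Its group structure,
topology and smooth structure are the product ones. -/
abbrev Torus (k : ℕ) : Type := Fin k → Circle

/-- The exponential map `ℝ^k → T^k` of the torus. -/
noncomputable def torusExp {k : ℕ} (v : Fin k → ℝ) : Torus k := fun i => Circle.exp (v i)

/-- The Lie algebra of a subgroup `H` of the torus: all directions `v` whose one-parameter subgroup
`t ↦ exp (t v)` lies in `H`. -/
def torusLieAlgebra {k : ℕ} (H : Subgroup (Torus k)) : Submodule ℝ (Fin k → ℝ) where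
  carrier := {v | ∀ t : ℝ, torusExp (t • v) ∈ H}
  zero_mem' := by
    intro t
    have h : torusExp (t • (0 : Fin k → ℝ)) = 1 := by
      funext i
      simp [torusExp]
    rw [h]
    exact H.one_mem
  add_mem' := by
    intro v w hv hw t
    have h : torusExp (t • (v + w)) = torusExp (t • v) * torusExp (t • w) := by
      funext i
      simp [torusExp, mul_add, Circle.exp_add]
    rw [h]
    exact H.mul_mem (hv t) (hw t)
  smul_mem' := by
    intro c v hv t
    rw [smul_smul]
    exact hv (t * c)

/-- The dimension of the isotropy group of `x` under an action of the torus. -/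
noncomputable def isotropyDim {k : ℕ} {M : Type*} [MulAction (Torus k) M] (x : M) : ℕ :=
  Module.finrank ℝ (torusLieAlgebra (MulAction.stabilizer (Torus k) x))

/-- The orbit of `x` is principal: its isotropy group is the smallest possible, that is, up to
conjugation it is contained in every isotropy group of the action. -/
def IsPrincipalOrbit (G : Type*) [Group G] {M : Type*} [MulAction G M] (x : M) : Prop :=
  ∀ y : M, ∃ g : G, MulAction.stabilizer G (g • x) ≤ MulAction.stabilizer G y

/-- The orbit of `x` is singular: its isotropy group has strictly larger dimension than the
principal isotropy group. -/
def IsSingularOrbit (k : ℕ) {M : Type*} [MulAction (Torus k) M] (x : M) : Prop :=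
  ∃ y : M, IsPrincipalOrbit (Torus k) y ∧
    isotropyDim (k := k) y < isotropyDim (k := k) x

/-- The orbit space `M^* = M / G`, with the quotient topology. -/
abbrev OrbitSpace (G M : Type*) [Group G] [MulAction G M] : Type _ :=
  Quotient (MulAction.orbitRel G M)

/-- The orbit map `π : M → M / G`. -/
def orbitMap (G : Type*) {M : Type*} [Group G] [MulAction G M] (x : M) : OrbitSpace G M :=
  Quotient.mk (MulAction.orbitRel G M) x

/-- The closed unit disk `D^d` in Euclidean `d`-space. -/
abbrev Disk (d : ℕ) : Type := Metric.closedBall (0 : EuclideanSpace ℝ (Fin d)) 1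

/-!
The argument is topological, and rests on weight functions: functions `f : M → ℂ` with
`f (g • x) = χ g * f x` for a character `χ` of the torus. Fourier averaging along the orbits produces
enough continuous weight functions to separate the points of every orbit (`exists_weightFun_ne`), so
a section converges at an orbit as soon as all weight functions that do not vanish there converge
along it (`exists_tendsto_of_forall_weightFun`). The characters `χ` which have a weight function that
does not vanish at `x` form a lattice `L x`, the annihilator of the isotropy group of `x`
(`mem_weightLattice_iff_stabilizer`). A weight function that does not vanish at `x` does not vanish
near `x`, so `L x ≤ L y` for `y` near `x`.

Over the open disk the isotropy group is constant, hence so is `L`. Circle bundles over `ℝ^d` are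
trivial (`exists_continuous_weightFun_ne_zero`), so a basis of `L` gives unit weight functions over
the open disk, and prescribing the value `1` for each of them defines a section `s₀` there
(`exists_continuousOn_section`).

In general `s₀` does not converge at the boundary, but it may be replaced by its twist
`z ↦ torusExp (F z) • s₀ z` by a function `F` from the open disk to the Lie algebra `ℝ^k`. On small
convex pieces of the open disk one may take logarithms of the values of weight functions along `s₀`.
Convergence of the twist at `x` then becomes convergence of real functions, each of the form
`θ + charDeriv χ ∘ F` with `χ ∈ L x`. These conditions on `F` are affine, so local solutions can be
glued by a partition of unity (`exists_twist_of_local`). Local solutions are found by decreasing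
induction on the rank of `L x`: a solution for the orbits of larger rank is corrected near `x` in
directions dual to a basis of `L x`, which does not disturb the convergence obtained before
(`exists_local_twist`). The twist that converges everywhere extends continuously to the closed disk.
-/

open Filter Topology MeasureTheory

/-! ### Weight functions and characters of the torus -/

/-- A function `f : X → ℂ` has weight `c`, for a character `c : G → S¹`, if it is equivariant along
`c`: `f (g • x) = c g * f x`. No continuity is included. For `c = 1` this says that `f` is constant
on orbits. -/
def IsWeightFun {G X : Type*} [Group G] [MulAction G X] (c : G →* Circle) (f : X → ℂ) : Prop :=
  ∀ (g : G) (x : X), f (g • x) = c g * f x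

namespace IsWeightFun
variable {G X : Type*} [Group G] [MulAction G X] {c c' : G →* Circle} {f f' : X → ℂ}

theorem one : IsWeightFun (1 : G →* Circle) (fun _ : X => (1 : ℂ)) := by
  intro g x; simp

theorem mul (h : IsWeightFun c f) (h' : IsWeightFun c' f') :
    IsWeightFun (c * c') (fun x => f x * f' x) := by
  intro g x
  simp only [h g x, h' g x, MonoidHom.mul_apply, Circle.coe_mul]
  ring

theorem inv (h : IsWeightFun c f) : IsWeightFun c⁻¹ (fun x => (f x)⁻¹) := by
  intro g x
  simp only [h g x, MonoidHom.inv_apply, Circle.coe_inv, mul_inv]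

theorem conj (h : IsWeightFun c f) : IsWeightFun c⁻¹ (fun x => (starRingEnd ℂ) (f x)) := by
  intro g x
  simp only [h g x, MonoidHom.inv_apply, Circle.coe_inv_eq_conj, map_mul]

theorem zpow (h : IsWeightFun c f) (n : ℤ) : IsWeightFun (c ^ n) (fun x => f x ^ n) := by
  intro g x
  simp only [h g x, mul_zpow, ← Circle.coe_zpow]
  rfl

theorem prod {ι : Type*} (s : Finset ι) {c : ι → G →* Circle} {f : ι → X → ℂ}
    (h : ∀ i ∈ s, IsWeightFun (c i) (f i)) :
    IsWeightFun (∏ i ∈ s, c i) (fun x => ∏ i ∈ s, f i x) := by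
  classical
  induction s using Finset.induction_on with
  | empty => simpa using! one
  | insert a s ha ih =>
    simp only [Finset.prod_insert ha]
    exact (h a (by simp)).mul (ih fun i hi => h i (by simp [hi]))

theorem norm_smul (h : IsWeightFun c f) (g : G) (x : X) : ‖f (g • x)‖ = ‖f x‖ := by
  rw [h g x, norm_mul, Circle.norm_coe, one_mul]

theorem ne_zero_smul (h : IsWeightFun c f) (g : G) (x : X) : f (g • x) ≠ 0 ↔ f x ≠ 0 := by
  simp [h g x]

theorem norm (h : IsWeightFun c f) : IsWeightFun (1 : G →* Circle) (fun x => (‖f x‖ : ℂ)) := by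
  intro g x
  simp [h.norm_smul]

theorem div_norm (h : IsWeightFun c f) : IsWeightFun c (fun x => f x / ‖f x‖) := by
  intro g x
  change f (g • x) / ‖f (g • x)‖ = c g * (f x / ‖f x‖)
  rw [h.norm_smul, h g x, mul_div_assoc]

end IsWeightFun

/-- The character `g ↦ ∏ i, g i ^ χ i` of the torus with exponent vector `χ ∈ ℤ^k`. -/
noncomputable def torusChar {k : ℕ} (χ : Fin k → ℤ) : Torus k →* Circle where
  toFun g := ∏ i, g i ^ χ i
  map_one' := by simp
  map_mul' g h := by simp [mul_zpow, Finset.prod_mul_distrib]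

section torusChar
variable {k : ℕ}

theorem torusChar_add (χ ψ : Fin k → ℤ) : torusChar (χ + ψ) = torusChar χ * torusChar ψ := by
  ext g
  simp [torusChar, zpow_add, Finset.prod_mul_distrib]

theorem torusChar_zero : torusChar (0 : Fin k → ℤ) = 1 := by
  ext g
  simp [torusChar]

theorem torusChar_neg (χ : Fin k → ℤ) : torusChar (-χ) = (torusChar χ)⁻¹ := by
  ext g
  simp [torusChar]

theorem torusChar_zsmul (n : ℤ) (χ : Fin k → ℤ) : torusChar (n • χ) = torusChar χ ^ n := by
  refine MonoidHom.ext fun g => ?_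
  simp [torusChar, zpow_mul', ← Finset.prod_zpow]

theorem torusChar_sum {ι : Type*} (s : Finset ι) (χ : ι → Fin k → ℤ) :
    torusChar (∑ i ∈ s, χ i) = ∏ i ∈ s, torusChar (χ i) := by
  classical
  induction s using Finset.induction_on with
  | empty => simpa using torusChar_zero
  | insert a s ha ih => rw [Finset.sum_insert ha, torusChar_add, ih, Finset.prod_insert ha]

theorem torusChar_torusExp (χ : Fin k → ℤ) (v : Fin k → ℝ) :
    torusChar χ (torusExp v) = Circle.exp (∑ i, χ i * v i) := by
  have h : ∀ (s : Finset (Fin k)) (u : Fin k → ℝ),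
      Circle.exp (∑ i ∈ s, u i) = ∏ i ∈ s, Circle.exp (u i) := by
    intro s u
    induction s using Finset.induction_on with
    | empty => simp
    | insert a s ha ih => rw [Finset.sum_insert ha, Circle.exp_add, ih, Finset.prod_insert ha]
  rw [h]
  simp only [torusChar, torusExp, MonoidHom.coe_mk, OneHom.coe_mk, Circle.exp_intCast_mul]

theorem continuous_torusChar (χ : Fin k → ℤ) : Continuous (torusChar χ) := by
  change Continuous fun g : Torus k => ∏ i, g i ^ χ i
  fun_prop

theorem continuous_torusExp : Continuous (torusExp : (Fin k → ℝ) → Torus k) := by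
  unfold torusExp
  fun_prop

theorem torusExp_add (v w : Fin k → ℝ) : torusExp (v + w) = torusExp v * torusExp w := by
  funext i
  simp [torusExp, Circle.exp_add]

end torusChar

/-! ### Fourier averaging along orbits -/

section average
open UnitAddTorus
variable {k : ℕ}

-- The probability Haar measure on `ℝ / ℤ`, the measure for which `mFourierCoeff` is defined.
noncomputable local instance : MeasureSpace UnitAddCircle := ⟨AddCircle.haarAddCircle⟩
local instance : Measure.IsAddHaarMeasure (volume : Measure UnitAddCircle) :=
  inferInstanceAs (Measure.IsAddHaarMeasure AddCircle.haarAddCircle)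
local instance : IsProbabilityMeasure (volume : Measure UnitAddCircle) :=
  inferInstanceAs (IsProbabilityMeasure AddCircle.haarAddCircle)

/-- The isomorphism `(ℝ / ℤ)^k → T^k`, which transports the Fourier analysis on `UnitAddTorus` to
`Torus k`. -/
noncomputable def torusOfAddTorus (t : UnitAddTorus (Fin k)) : Torus k := fun i => (t i).toCircle

theorem continuous_torusOfAddTorus : Continuous (torusOfAddTorus (k := k)) := by
  unfold torusOfAddTorus
  exact continuous_pi fun i => AddCircle.continuous_toCircle.comp (continuous_apply i)

theorem torusOfAddTorus_add (s t : UnitAddTorus (Fin k)) :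
    torusOfAddTorus (s + t) = torusOfAddTorus s * torusOfAddTorus t := by
  funext i
  simp [torusOfAddTorus, AddCircle.toCircle_add]

theorem torusOfAddTorus_zero : torusOfAddTorus (0 : UnitAddTorus (Fin k)) = 1 := by
  funext i
  simp [torusOfAddTorus]

theorem torusOfAddTorus_surjective : Function.Surjective (torusOfAddTorus (k := k)) := by
  intro g
  have h : ∀ i, ∃ t : UnitAddCircle, t.toCircle = g i := fun i =>
    ⟨(AddCircle.homeomorphCircle one_ne_zero).symm (g i), by
      rw [← AddCircle.homeomorphCircle_apply one_ne_zero, Homeomorph.apply_symm_apply]⟩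
  choose t ht using h
  exact ⟨t, funext ht⟩

theorem torusChar_torusOfAddTorus (χ : Fin k → ℤ) (t : UnitAddTorus (Fin k)) :
    (torusChar χ (torusOfAddTorus t) : ℂ) = mFourier χ t := by
  simp only [torusChar, torusOfAddTorus, mFourier, MonoidHom.coe_mk, OneHom.coe_mk,
    ContinuousMap.coe_mk, fourier_apply, AddCircle.toCircle_zsmul]
  exact map_prod Circle.coeHom _ _

variable {M : Type*} [MulAction (Torus k) M]

/-- The component of weight `χ` of `f`: at `x` it is the `χ`-th Fourier coefficient of the function
`t ↦ f (t • x)` on the torus. -/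
noncomputable def weightAverage (χ : Fin k → ℤ) (f : M → ℂ) (x : M) : ℂ :=
  mFourierCoeff (fun t => f (torusOfAddTorus t • x)) χ

theorem isWeightFun_weightAverage (χ : Fin k → ℤ) (f : M → ℂ) :
    IsWeightFun (torusChar χ) (weightAverage χ f) := by
  intro g x
  obtain ⟨s, rfl⟩ := torusOfAddTorus_surjective g
  simp only [weightAverage, mFourierCoeff, smul_smul, ← torusOfAddTorus_add]
  rw [torusChar_torusOfAddTorus, ← integral_const_mul,
    ← integral_add_right_eq_self (fun t => mFourier χ s *
      mFourier (-χ) t • f (torusOfAddTorus t • x)) s]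
  congr 1
  funext t
  have : mFourier χ s * mFourier (-χ) (t + s) = mFourier (-χ) t := by
    simp only [← torusChar_torusOfAddTorus, torusOfAddTorus_add, torusChar_neg,
      MonoidHom.inv_apply, map_mul, Circle.coe_mul, Circle.coe_inv]
    field_simp
  rw [smul_eq_mul, smul_eq_mul, ← this, mul_assoc]

variable [TopologicalSpace M]

theorem continuous_weightAverage [ContinuousSMul (Torus k) M] (χ : Fin k → ℤ) {f : M → ℂ} (hf : Continuous f) :
    Continuous (weightAverage χ f) := by
  let F : C(M, C(UnitAddTorus (Fin k), ℂ)) := ContinuousMap.curry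
    ⟨fun q : M × UnitAddTorus (Fin k) => mFourier (-χ) q.2 • f (torusOfAddTorus q.2 • q.1), by
      have := continuous_torusOfAddTorus (k := k)
      fun_prop⟩
  have hF : ∀ x, weightAverage χ f x =
      ∫ t, ContinuousMap.toLp (E := ℂ) 1 (volume : Measure (UnitAddTorus (Fin k))) ℂ (F x) t :=
    fun x => integral_congr_ae (ContinuousMap.coeFn_toLp _ (F x)).symm
  have h1 : Continuous fun x =>
      ContinuousMap.toLp (E := ℂ) 1 (volume : Measure (UnitAddTorus (Fin k))) ℂ (F x) :=
    (ContinuousMap.toLp (E := ℂ) 1 (volume : Measure (UnitAddTorus (Fin k))) ℂ).continuous.comp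
      F.continuous
  rw [funext hF]
  exact continuous_integral.comp h1

/-- Weight functions separate the points of an orbit. A continuous `f` with `f (g • x) ≠ f x` gives
two functions `t ↦ f (t • g • x)` and `t ↦ f (t • x)` on the torus; if no weight function separated
`g • x` from `x`, these would have the same Fourier coefficients, hence agree at `t = 1`. -/
theorem exists_weightFun_ne [ContinuousSMul (Torus k) M] [CompactSpace M] [T2Space M]
    {x : M} {g : Torus k} (hg : g • x ≠ x) :
    ∃ (χ : Fin k → ℤ) (f : M → ℂ), Continuous f ∧ IsWeightFun (torusChar χ) f ∧ f x ≠ 0 ∧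
      f (g • x) ≠ f x := by
  by_contra! hcon
  obtain ⟨u, hu0, hu1, -⟩ := exists_continuous_zero_one_of_isClosed (X := M)
    isClosed_singleton isClosed_singleton (Set.disjoint_singleton.2 hg)
  set f : M → ℂ := fun y => (u y : ℂ) with hf
  have hfc : Continuous f := by fun_prop
  have hw : ∀ χ : Fin k → ℤ, weightAverage χ f (g • x) = weightAverage χ f x := by
    intro χ
    by_cases h : weightAverage χ f x = 0
    · rw [h, isWeightFun_weightAverage χ f g x, h, mul_zero]
    · exact hcon χ _ (continuous_weightAverage χ hfc) (isWeightFun_weightAverage χ f) h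
  let D : C(UnitAddTorus (Fin k), ℂ) :=
    ⟨fun t => f (torusOfAddTorus t • g • x) - f (torusOfAddTorus t • x), by
      have := continuous_torusOfAddTorus (k := k)
      fun_prop⟩
  have hD : mFourierCoeff D = 0 := by
    funext χ
    have hi : ∀ y : M, Integrable (fun t : UnitAddTorus (Fin k) =>
        mFourier (-χ) t • f (torusOfAddTorus t • y)) := fun y => by
      have := continuous_torusOfAddTorus (k := k)
      exact (Continuous.integrable_of_hasCompactSupport (by fun_prop)
        (HasCompactSupport.of_compactSpace _))
    have : mFourierCoeff D χ = weightAverage χ f (g • x) - weightAverage χ f x := by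
      simp only [weightAverage, mFourierCoeff]
      rw [← integral_sub (hi _) (hi _)]
      simp only [D, ContinuousMap.coe_mk, smul_sub]
    rw [this, hw, sub_self]
    rfl
  have hs := hasSum_mFourier_series_apply_of_summable (f := D) (by rw [hD]; exact summable_zero) 0
  rw [hD] at hs
  have h0 : D 0 = 0 := by simpa using hs.unique (by simp)
  have h1 : f (g • x) - f x = 0 := by
    simpa [D, torusOfAddTorus_zero] using h0
  have h2 : u (g • x) = 0 := hu0 rfl
  have h3 : u x = 1 := hu1 rfl
  simp [hf, h2, h3] at h1

/-- The lattice of the exponent vectors `χ ∈ ℤ^k` for which some continuous function of weight `χ`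
does not vanish at `x`. It depends only on the orbit of `x`, and consists of the characters that are
trivial on the isotropy group of `x` (`mem_weightLattice_iff_stabilizer`). -/
noncomputable def weightLattice (k : ℕ) {M : Type*} [MulAction (Torus k) M] [TopologicalSpace M]
    (x : M) : Submodule ℤ (Fin k → ℤ) :=
  AddSubgroup.toIntSubmodule
    { carrier := {χ | ∃ f : M → ℂ, Continuous f ∧ IsWeightFun (torusChar χ) f ∧ f x ≠ 0}
      zero_mem' := ⟨fun _ => 1, continuous_const, by
        rw [torusChar_zero]; exact IsWeightFun.one, one_ne_zero⟩
      add_mem' := by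
        rintro χ ψ ⟨f, hf, hχ, hx⟩ ⟨f', hf', hψ, hx'⟩
        exact ⟨_, hf.mul hf', by rw [torusChar_add]; exact hχ.mul hψ, mul_ne_zero hx hx'⟩
      neg_mem' := by
        rintro χ ⟨f, hf, hχ, hx⟩
        exact ⟨_, Complex.continuous_conj.comp hf, by rw [torusChar_neg]; exact hχ.conj,
          by simpa using hx⟩ }

/-- The weight lattice of `x` is the annihilator of the isotropy group of `x`. If `χ` is trivial on
that group, then `g • x ↦ χ g` is a continuous function on the orbit; the weight `χ` component of a
Tietze extension of it to `M` is nonzero at `x`. -/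
theorem mem_weightLattice_iff_stabilizer [ContinuousSMul (Torus k) M] [CompactSpace M] [T2Space M]
    {x : M} {χ : Fin k → ℤ} :
    χ ∈ weightLattice k x ↔ ∀ g ∈ MulAction.stabilizer (Torus k) x, torusChar χ g = 1 := by
  constructor
  · rintro ⟨f, -, hw, hx⟩ g hg
    have h := hw g x
    rw [MulAction.mem_stabilizer_iff.1 hg] at h
    exact Circle.coe_injective (mul_right_cancel₀ hx (by simpa using h.symm))
  · intro h
    let o : C(Torus k, MulAction.orbit (Torus k) x) :=
      ⟨fun g => ⟨g • x, g, rfl⟩, by fun_prop⟩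
    have hoc : Continuous o := o.continuous
    have hos : Function.Surjective o := by
      rintro ⟨_, g, rfl⟩
      exact ⟨g, rfl⟩
    have hq : IsQuotientMap o := hoc.isClosedMap.isQuotientMap hoc hos
    let e : C(Torus k, ℂ) := ⟨fun g => torusChar χ g, by
      have := continuous_torusChar χ
      fun_prop⟩
    have he : Function.FactorsThrough e o := by
      intro a b hab
      have h1 : a • x = b • x := congrArg Subtype.val hab
      have h2 := h (b⁻¹ * a) (by rw [MulAction.mem_stabilizer_iff, mul_smul, h1, inv_smul_smul])
      rw [map_mul, map_inv, inv_mul_eq_one] at h2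
      simp [e, h2]
    have hcl : IsClosed (MulAction.orbit (Torus k) x) := by
      have : MulAction.orbit (Torus k) x = Set.range fun g : Torus k => g • x := rfl
      rw [this]
      exact (isCompact_range (by fun_prop)).isClosed
    obtain ⟨F, hF⟩ := ContinuousMap.exists_restrict_eq hcl (Topology.IsQuotientMap.lift hq e he)
    have hFv : ∀ g : Torus k, F (g • x) = torusChar χ g := by
      intro g
      have h1 := congrArg (fun q : C(MulAction.orbit (Torus k) x, ℂ) => q (o g)) hF
      have h2 : (Topology.IsQuotientMap.lift hq e he) (o g) = e g :=
        congrArg (fun q : C(Torus k, ℂ) => q g) (Topology.IsQuotientMap.lift_comp hq e he)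
      exact h1.trans h2
    refine ⟨weightAverage χ F, continuous_weightAverage χ F.continuous,
      isWeightFun_weightAverage χ F, ?_⟩
    have : weightAverage χ F x = 1 := by
      simp only [weightAverage, mFourierCoeff, hFv, torusChar_torusOfAddTorus, smul_eq_mul,
        ← mFourier_add]
      simp [mFourier_zero]
    rw [this]
    exact one_ne_zero

end average

/-! ### Nowhere vanishing weight functions over `ℝ^d` -/

/-- Convergence along a set-theoretic section `f` of `p` of a function `u` which is constant on the
fibres of `p`: it is enough that `u` converges along a filter whose image under `p` is coarser than
`l`. The section need not have any continuity. -/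
theorem tendsto_comp_of_factorsThrough {X B Y : Type*} [TopologicalSpace Y] {p : X → B} {u : X → Y}
    {f : B → X} {F : Filter X} {l : Filter B} {v : Y} (hl : l ≤ map p F)
    (hu : Function.FactorsThrough u p) (huv : Tendsto u F (𝓝 v)) (hf : ∀ᶠ z in l, p (f z) = z) :
    Tendsto (fun z => u (f z)) l (𝓝 v) := by
  intro W hW
  have h : p '' (u ⁻¹' W) ∈ l := hl (image_mem_map (huv hW))
  rw [mem_map]
  filter_upwards [h, hf] with z hz hfz
  obtain ⟨x, hx, rfl⟩ := hz
  change u (f (p x)) ∈ W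
  rw [hu hfz]
  exact hx

section Box
variable {G X B : Type*} [Group G] [MulAction G X] [TopologicalSpace X] [TopologicalSpace B]

variable (G) in
/-- `P` is a continuous open surjection whose fibres are the orbits of `G`, that is, up to a
homeomorphism of the target it is the orbit map of `G`. -/
structure IsOpenOrbitMap (P : X → B) : Prop where
  continuous : Continuous P
  isOpenMap : IsOpenMap P
  surjective : Function.Surjective P
  eq_iff : ∀ x y, P x = P y ↔ ∃ g : G, g • x = y

namespace IsOpenOrbitMap
variable {P : X → B}

theorem apply_smul (h : IsOpenOrbitMap G P) (g : G) (x : X) : P (g • x) = P x :=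
  ((h.eq_iff _ _).2 ⟨g, rfl⟩).symm

theorem factorsThrough (h : IsOpenOrbitMap G P) {u : X → ℂ}
    (hu : IsWeightFun (1 : G →* Circle) u) : Function.FactorsThrough u P := by
  intro x y hxy
  obtain ⟨g, rfl⟩ := (h.eq_iff x y).1 hxy
  simp [hu g x]

theorem continuousOn_comp (h : IsOpenOrbitMap G P) {u : X → ℂ}
    (hu : IsWeightFun (1 : G →* Circle) u) {C : Set B} (huc : ContinuousOn u (P ⁻¹' C))
    {f : B → X} (hf : ∀ z, P (f z) = z) : ContinuousOn (fun z => u (f z)) C := by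
  intro z hz
  have hz' : f z ∈ P ⁻¹' C := by simpa [hf z] using hz
  refine tendsto_comp_of_factorsThrough (p := P) (F := 𝓝[P ⁻¹' C] (f z)) ?_ (h.factorsThrough hu)
    (huc _ hz') (.of_forall hf)
  have h1 : map P (𝓝 (f z)) = 𝓝 z := by
    conv_rhs => rw [← hf z]
    exact le_antisymm h.continuous.continuousAt (h.isOpenMap.nhds_le _)
  simp only [nhdsWithin, map_inf_principal_preimage, h1, le_refl]

end IsOpenOrbitMap

/-- `Φ` has weight `c` everywhere, and over the set `C` it is continuous and nowhere zero. -/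
def IsNonvanishingWeightFunOn (c : G →* Circle) (P : X → B) (C : Set B) (Φ : X → ℂ) : Prop :=
  IsWeightFun c Φ ∧ ContinuousOn Φ (P ⁻¹' C) ∧ ∀ x, P x ∈ C → Φ x ≠ 0

theorem IsNonvanishingWeightFunOn.mono {B : Type*} {c : G →* Circle} {P : X → B} {C C' : Set B} {Φ : X → ℂ}
    (h : IsNonvanishingWeightFunOn c P C Φ) (hC : C' ⊆ C) : IsNonvanishingWeightFunOn c P C' Φ :=
  ⟨h.1, h.2.1.mono (Set.preimage_mono hC), fun x hx => h.2.2 x (hC hx)⟩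

/-- Gluing of weight functions that agree over the intersection of two closed sets. -/
theorem IsNonvanishingWeightFunOn.union {c : G →* Circle} {P : X → B} (hP : IsOpenOrbitMap G P)
    {C₁ C₂ : Set B} {Φ₁ Φ₂ : X → ℂ} (h₁ : IsNonvanishingWeightFunOn c P C₁ Φ₁)
    (h₂ : IsNonvanishingWeightFunOn c P C₂ Φ₂) (hC₁ : IsClosed C₁) (hC₂ : IsClosed C₂)
    (h : ∀ x, P x ∈ C₁ → P x ∈ C₂ → Φ₂ x = Φ₁ x) :
    ∃ Φ, IsNonvanishingWeightFunOn c P (C₁ ∪ C₂) Φ := by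
  classical
  let Φ : X → ℂ := fun x => if P x ∈ C₁ then Φ₁ x else Φ₂ x
  have e₁ : ∀ x, P x ∈ C₁ → Φ x = Φ₁ x := fun x hx => if_pos hx
  have e₂ : ∀ x, P x ∈ C₂ → Φ x = Φ₂ x := fun x hx => by
    by_cases hx1 : P x ∈ C₁
    · rw [e₁ x hx1, h x hx1 hx]
    · exact if_neg hx1
  refine ⟨Φ, fun g x => ?_, ?_, ?_⟩
  · simp only [Φ, hP.apply_smul, h₁.1 g x, h₂.1 g x]
    split_ifs <;> rfl
  · rw [Set.preimage_union]
    exact (h₁.2.1.congr e₁).union_of_isClosed (h₂.2.1.congr e₂) (hC₁.preimage hP.continuous)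
      (hC₂.preimage hP.continuous)
  · rintro x (hx | hx)
    · rw [e₁ x hx]; exact h₁.2.2 x hx
    · rw [e₂ x hx]; exact h₂.2.2 x hx

variable {ι : Type*} {P : X → ι → ℝ} {c : G →* Circle}

/-- A weight function over `C` can be changed so as to agree over a box `[a, b] ⊆ C` with a given
one: the quotient of the two is a function on the box, which extends to `ℝ^d` by the retraction of
`ℝ^d` onto the box. -/
theorem IsNonvanishingWeightFunOn.exists_eqOn (hP : IsOpenOrbitMap G P) {a b : ι → ℝ} (hab : a ≤ b)
    {C : Set (ι → ℝ)} (hC : Set.Icc a b ⊆ C) {Φ₁ Φ₂ : X → ℂ}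
    (h₁ : IsNonvanishingWeightFunOn c P (Set.Icc a b) Φ₁)
    (h₂ : IsNonvanishingWeightFunOn c P C Φ₂) :
    ∃ Φ, IsNonvanishingWeightFunOn c P C Φ ∧ ∀ x, P x ∈ Set.Icc a b → Φ x = Φ₁ x := by
  let f := Function.surjInv hP.surjective
  have hf : ∀ z, P (f z) = z := Function.surjInv_eq hP.surjective
  let K : (ι → ℝ) → (ι → ℝ) := fun z => a ⊔ (z ⊓ b)
  have hKc : Continuous K := continuous_pi fun i =>
    continuous_const.sup ((continuous_apply i).inf continuous_const)
  have hKm : ∀ z, K z ∈ Set.Icc a b := fun z => ⟨le_sup_left, sup_le hab inf_le_right⟩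
  have hKe : ∀ z ∈ Set.Icc a b, K z = z := fun z hz => by
    simp only [K, inf_eq_left.2 hz.2, sup_eq_right.2 hz.1]
  let u : X → ℂ := fun x => Φ₁ x * (Φ₂ x)⁻¹
  have hu : IsWeightFun (1 : G →* Circle) u := by
    rw [← mul_inv_cancel c]
    exact h₁.1.mul h₂.1.inv
  have huc : ContinuousOn u (P ⁻¹' Set.Icc a b) :=
    h₁.2.1.mul ((h₂.mono hC).2.1.inv₀ (h₂.mono hC).2.2)
  have hr : Continuous fun z => u (f (K z)) :=
    (hP.continuousOn_comp hu huc hf).comp_continuous hKc hKm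
  have hr0 : ∀ z, u (f (K z)) ≠ 0 := fun z => by
    have h : P (f (K z)) ∈ Set.Icc a b := by rw [hf]; exact hKm z
    exact mul_ne_zero (h₁.2.2 _ h) (inv_ne_zero (h₂.2.2 _ (hC h)))
  refine ⟨fun x => Φ₂ x * u (f (K (P x))), ⟨fun g x => ?_, ?_, fun x hx => ?_⟩, fun x hx => ?_⟩
  · simp only [hP.apply_smul, h₂.1 g x, mul_assoc]
  · exact h₂.2.1.mul (hr.comp hP.continuous).continuousOn
  · exact mul_ne_zero (h₂.2.2 x hx) (hr0 _)
  · have : u (f (P x)) = u x := hP.factorsThrough hu (hf _)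
    simp only [hKe _ hx, this, u]
    field_simp [h₂.2.2 x (hC hx)]

theorem exists_isNonvanishingWeightFunOn_Icc_of_split [DecidableEq ι] (hP : IsOpenOrbitMap G P)
    {a b : ι → ℝ} {i : ι} {m : ℝ} (hab : a ≤ b) (ham : a i ≤ m) (hmb : m ≤ b i)
    (h₁ : ∃ Φ, IsNonvanishingWeightFunOn c P (Set.Icc a (Function.update b i m)) Φ)
    (h₂ : ∃ Φ, IsNonvanishingWeightFunOn c P (Set.Icc (Function.update a i m) b) Φ) :
    ∃ Φ, IsNonvanishingWeightFunOn c P (Set.Icc a b) Φ := by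
  obtain ⟨Φ₁, h₁⟩ := h₁
  obtain ⟨Φ₂, h₂⟩ := h₂
  have hle : Function.update a i m ≤ Function.update b i m := by
    intro j
    by_cases hj : j = i
    · subst hj; simp
    · simp [hj, hab j]
  have ha : a ≤ Function.update a i m := by simp [ham]
  have hb : Function.update b i m ≤ b := by simp [hmb]
  obtain ⟨Φ, hΦ, hΦe⟩ := IsNonvanishingWeightFunOn.exists_eqOn hP hle
    (Set.Icc_subset_Icc le_rfl hb) (h₁.mono (Set.Icc_subset_Icc ha le_rfl)) h₂
  obtain ⟨Ψ, hΨ⟩ := h₁.union hP hΦ isClosed_Icc isClosed_Icc fun x hx hx' => hΦe x ⟨hx'.1, hx.2⟩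
  refine ⟨Ψ, hΨ.mono fun z hz => ?_⟩
  rcases le_total (z i) m with h | h
  · left
    refine ⟨hz.1, fun j => ?_⟩
    by_cases hj : j = i
    · subst hj; simpa using h
    · simpa [hj] using hz.2 j
  · right
    refine ⟨fun j => ?_, hz.2⟩
    by_cases hj : j = i
    · subst hj; simpa using h
    · simpa [hj] using hz.1 j

/-- Local nonvanishing weight functions give one over any box, by bisection: the halves of a box
along a coordinate meet in a common face, which is a retract. -/
theorem exists_isNonvanishingWeightFunOn_box [Fintype ι] (hP : IsOpenOrbitMap G P)
    (hloc : ∀ x, ∃ Φ : X → ℂ, Continuous Φ ∧ IsWeightFun c Φ ∧ Φ x ≠ 0) (I : BoxIntegral.Box ι) :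
    ∃ Φ, IsNonvanishingWeightFunOn c P (BoxIntegral.Box.Icc I) Φ := by
  classical
  refine BoxIntegral.Box.subbox_induction_on' (p := fun I : BoxIntegral.Box ι =>
    ∃ Φ, IsNonvanishingWeightFunOn c P (BoxIntegral.Box.Icc I) Φ) I ?_ ?_
  · intro J _ hJ
    let m : ι → ℝ := fun i => (J.lower i + J.upper i) / 2
    have hm : ∀ i, J.lower i ≤ m i ∧ m i ≤ J.upper i := fun i => by
      have := J.lower_le_upper i
      constructor <;> simp only [m] <;> linarith
    have congr_Icc : ∀ {a b a' b' : ι → ℝ}, a' = a → b' = b →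
        (∃ Φ, IsNonvanishingWeightFunOn c P (Set.Icc a b) Φ) →
        ∃ Φ, IsNonvanishingWeightFunOn c P (Set.Icc a' b') Φ := by
      rintro _ _ _ _ rfl rfl h
      exact h
    -- The boxes that are full in the coordinates of `t`, and in each other coordinate are the upper
    -- or the lower half of `J`, as prescribed by `s`.
    have key : ∀ t : Finset ι, ∀ s : Set ι, ∃ Φ, IsNonvanishingWeightFunOn c P
        (Set.Icc (fun i => if i ∈ t then J.lower i else if i ∈ s then m i else J.lower i)
          (fun i => if i ∈ t then J.upper i else if i ∈ s then J.upper i else m i)) Φ := by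
      intro t
      induction t using Finset.induction_on with
      | empty =>
        intro s
        refine congr_Icc ?_ ?_ (hJ s) <;> funext i <;>
          simp [BoxIntegral.Box.splitCenterBox, Set.piecewise, m]
      | insert j t hj ih =>
        intro s
        refine exists_isNonvanishingWeightFunOn_Icc_of_split hP (i := j) (m := m j) ?_ ?_ ?_ ?_ ?_
        · intro i
          have := hm i
          dsimp only
          split_ifs <;> linarith
        · simpa using (hm j).1
        · simpa using (hm j).2
        · refine congr_Icc ?_ ?_ (ih (s \ {j})) <;>
          · funext i
            by_cases hi : i = j
            · subst hi; simp [hj]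
            · simp [hi]
        · refine congr_Icc ?_ ?_ (ih (insert j s)) <;>
          · funext i
            by_cases hi : i = j
            · subst hi; simp [hj]
            · simp [hi]
    simpa [BoxIntegral.Box.Icc_def] using key Finset.univ ∅
  · intro z _
    obtain ⟨x, rfl⟩ := hP.surjective z
    obtain ⟨Φ, hc, hw, hx⟩ := hloc x
    have hV : IsOpen {y | Φ y ≠ 0} := isOpen_ne_fun hc continuous_const
    refine ⟨P '' {y | Φ y ≠ 0}, mem_nhdsWithin_of_mem_nhds
      ((hP.isOpenMap _ hV).mem_nhds ⟨x, hx, rfl⟩), fun J _ _ _ hJ _ =>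
      ⟨Φ, hw, hc.continuousOn, fun y hy => ?_⟩⟩
    obtain ⟨y', hy', he⟩ := hJ hy
    obtain ⟨g, rfl⟩ := (hP.eq_iff _ _).1 he
    exact (hw.ne_zero_smul g y').2 hy'

/-- Over `ℝ^d` every circle bundle is trivial: if nonvanishing functions of weight `c` exist near
each point, there is a global one. It is the limit of functions over an exhaustion by boxes, each of
which agrees with the previous one over the previous box. -/
theorem exists_continuous_weightFun_ne_zero [Fintype ι] (hP : IsOpenOrbitMap G P)
    (hloc : ∀ x, ∃ Φ : X → ℂ, Continuous Φ ∧ IsWeightFun c Φ ∧ Φ x ≠ 0) :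
    ∃ Φ : X → ℂ, Continuous Φ ∧ IsWeightFun c Φ ∧ ∀ x, Φ x ≠ 0 := by
  let a : ℕ → ι → ℝ := fun N _ => -(N + 1 : ℝ)
  let b : ℕ → ι → ℝ := fun N _ => (N + 1 : ℝ)
  have hbox : ∀ N, ∃ Φ, IsNonvanishingWeightFunOn c P (Set.Icc (a N) (b N)) Φ := fun N =>
    exists_isNonvanishingWeightFunOn_box hP hloc
      ⟨a N, b N, fun i => by simp only [a, b]; linarith [N.cast_nonneg (α := ℝ)]⟩
  have hstep : ∀ N Φ, IsNonvanishingWeightFunOn c P (Set.Icc (a N) (b N)) Φ →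
      ∃ Φ', IsNonvanishingWeightFunOn c P (Set.Icc (a (N + 1)) (b (N + 1))) Φ' ∧
        ∀ x, P x ∈ Set.Icc (a N) (b N) → Φ' x = Φ x := fun N Φ h => by
    obtain ⟨Φ₂, h₂⟩ := hbox (N + 1)
    refine IsNonvanishingWeightFunOn.exists_eqOn hP (fun i => ?_)
      (Set.Icc_subset_Icc (fun i => ?_) (fun i => ?_)) h h₂ <;>
    · simp only [a, b]
      push_cast
      linarith [N.cast_nonneg (α := ℝ)]
  choose! next hnext using hstep
  obtain ⟨Φ₀, h₀⟩ := hbox 0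
  let Φ : ℕ → X → ℂ := fun N => Nat.rec Φ₀ next N
  have hΦ : ∀ N, IsNonvanishingWeightFunOn c P (Set.Icc (a N) (b N)) (Φ N) := fun N => by
    induction N with
    | zero => exact h₀
    | succ N ih => exact (hnext N _ ih).1
  have hmono : ∀ N N', N ≤ N' → Set.Icc (a N) (b N) ⊆ Set.Icc (a N') (b N') := fun N N' h => by
    have : (N : ℝ) ≤ N' := by exact_mod_cast h
    refine Set.Icc_subset_Icc (fun i => ?_) (fun i => ?_) <;> simp only [a, b] <;> linarith
  have heq : ∀ N N', N ≤ N' → ∀ x, P x ∈ Set.Icc (a N) (b N) → Φ N' x = Φ N x := by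
    intro N N' h x hx
    induction N', h using Nat.le_induction with
    | base => rfl
    | succ N' h ih => exact ((hnext N' _ (hΦ N')).2 x (hmono N N' h hx)).trans ih
  let ν : (ι → ℝ) → ℕ := fun z => ⌈‖z‖⌉₊
  have hν : ∀ z z', dist z' z < 1 → z' ∈ Set.Icc (a (ν z)) (b (ν z)) := fun z z' h => by
    have h1 : ∀ i, |z' i| ≤ ν z + 1 := fun i => calc
      |z' i| ≤ ‖z'‖ := norm_le_pi_norm z' i
      _ ≤ ‖z‖ + ‖z' - z‖ := norm_le_norm_add_norm_sub' z' z
      _ ≤ ν z + 1 := add_le_add (Nat.le_ceil _) (by rw [← dist_eq_norm]; exact h.le)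
    exact ⟨fun i => (abs_le.1 (h1 i)).1, fun i => (abs_le.1 (h1 i)).2⟩
  have hν' : ∀ z, z ∈ Set.Icc (a (ν z)) (b (ν z)) := fun z => hν z z (by simp)
  refine ⟨fun x => Φ (ν (P x)) x, ?_, fun g x => ?_, fun x => (hΦ _).2.2 x (hν' _)⟩
  · rw [continuous_iff_continuousAt]
    intro x
    have hnear : ∀ᶠ y in 𝓝 x, dist (P y) (P x) < 1 :=
      hP.continuous.continuousAt.eventually (Metric.ball_mem_nhds _ one_pos)
    have hc : ContinuousAt (Φ (ν (P x))) x :=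
      (hΦ _).2.1.continuousAt (hnear.mono fun y hy => hν _ _ hy)
    refine hc.congr (hnear.mono fun y hy => ?_)
    rcases le_total (ν (P x)) (ν (P y)) with h | h
    · exact (heq _ _ h y (hν _ _ hy)).symm
    · exact heq _ _ h y (hν' _)
  · simp only [hP.apply_smul]
    exact (hΦ _).1 g x

end Box

/-! ### Partitions of unity, logarithms and dual vectors -/

section PartitionOfUnity

/-- A partition of unity on the open set `⋃ i, U i` subordinate to the `U i`, as functions on the
ambient space. The `ρ i` are continuous only at the points of the union. -/
theorem exists_partitionOfUnity_of_isOpen {E ι : Type*} [PseudoMetricSpace E] (U : ι → Set E)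
    (hU : ∀ i, IsOpen (U i)) :
    ∃ ρ : ι → E → ℝ, ∀ y ∈ ⋃ i, U i, (∀ i, ContinuousAt (ρ i) y) ∧
      ∃ t : Finset ι, (∀ i ∈ t, y ∈ U i) ∧
        ∀ᶠ z in 𝓝 y, ∑ i ∈ t, ρ i z = 1 ∧ ∀ i ∉ t, ρ i z = 0 := by
  classical
  have hW : IsOpen (⋃ i, U i) := isOpen_iUnion hU
  obtain ⟨ρ, hρ⟩ := PartitionOfUnity.exists_isSubordinate (X := (⋃ i, U i : Set E))
    (s := Set.univ) isClosed_univ (fun i => Subtype.val ⁻¹' U i)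
    (fun i => (hU i).preimage continuous_subtype_val) (fun y _ => by
      obtain ⟨i, hi⟩ := Set.mem_iUnion.1 y.2
      exact Set.mem_iUnion.2 ⟨i, hi⟩)
  refine ⟨fun i z => if h : z ∈ ⋃ i, U i then ρ i ⟨z, h⟩ else 0, fun y hy => ⟨fun i => ?_,
    ρ.fintsupport ⟨y, hy⟩, fun i hi => ?_, ?_⟩⟩
  · have h : ContinuousAt ((fun z => if h : z ∈ ⋃ i, U i then ρ i ⟨z, h⟩ else 0) ∘
        (Subtype.val : (⋃ i, U i : Set E) → E)) ⟨y, hy⟩ := by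
      have : ((fun z => if h : z ∈ ⋃ i, U i then ρ i ⟨z, h⟩ else 0) ∘
        (Subtype.val : (⋃ i, U i : Set E) → E)) = ρ i := by
        funext z
        simp only [Function.comp_apply, dif_pos z.2]
      rw [this]
      exact (ρ i).continuous.continuousAt
    exact hW.isOpenEmbedding_subtypeVal.continuousAt_iff.1 h
  · exact hρ i ((ρ.mem_fintsupport_iff _ i).1 hi)
  · have h1 := ρ.eventually_finsupport_subset ⟨y, hy⟩
    have h2 : ∀ᶠ z in 𝓝 y, ∀ h : z ∈ ⋃ i, U i, ρ.finsupport ⟨z, h⟩ ⊆ ρ.fintsupport ⟨y, hy⟩ := by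
      have h3 := hW.isOpenEmbedding_subtypeVal.map_nhds_eq ⟨y, hy⟩
      change ∀ᶠ z in 𝓝 (Subtype.val (⟨y, hy⟩ : (⋃ i, U i : Set E))), _
      rw [← h3, eventually_map]
      exact h1.mono fun z hz _ => hz
    filter_upwards [h2, hW.mem_nhds hy] with z hz hzW
    constructor
    · simp only [dif_pos hzW]
      rw [← ρ.sum_finsupport' (Set.mem_univ _) (hz hzW)]
    · intro i hi
      rw [dif_pos hzW]
      by_contra hne
      exact hi (hz hzW ((ρ.mem_finsupport _).2 hne))

end PartitionOfUnity

section Log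
variable {E : Type*} [NormedAddCommGroup E] [NormedSpace ℝ E]

/-- A continuous branch of the argument on an open convex set. -/
theorem exists_continuousOn_circleExp_eq {U : Set E} (hU : IsOpen U) (hc : Convex ℝ U) {u : E → ℂ}
    (hu : ContinuousOn u U) (h0 : ∀ z ∈ U, u z ≠ 0) :
    ∃ θ : E → ℝ, ContinuousOn θ U ∧ ∀ z ∈ U, u z / ‖u z‖ = Circle.exp (θ z) := by
  rcases U.eq_empty_or_nonempty with rfl | hne
  · exact ⟨0, by simp, by simp⟩
  have := hc.contractibleSpace hne
  have hs : IsSimplyConnected U := inferInstanceAs (SimplyConnectedSpace U)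
  obtain ⟨f, hf, hfu⟩ := Complex.exists_continuousOn_eqOn_exp_comp hs hU hu
    (by rintro ⟨z, hz, h⟩; exact h0 z hz h)
  refine ⟨fun z => (f z).im, Complex.continuous_im.comp_continuousOn hf, fun z hz => ?_⟩
  rw [← hfu hz, Function.comp_apply, Complex.norm_exp, Circle.coe_exp, Complex.ofReal_exp,
    ← Complex.exp_sub]
  congr 1
  apply Complex.ext <;> simp

/-- If `exp (i θ)` converges at a point `y` adherent to the convex set `O`, then so does `θ`,
because `O` meets every small ball at `y` in a connected set, on which `θ` cannot jump by a multiple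
of `2π`. -/
theorem exists_tendsto_of_tendsto_circleExp {O : Set E} (hO : Convex ℝ O) {y : E}
    [(𝓝[O] y).NeBot] {ε : ℝ} (hε : 0 < ε) {θ : E → ℝ}
    (hθ : ContinuousOn θ (Metric.ball y ε ∩ O)) {w : ℂ}
    (h : Tendsto (fun z => (Circle.exp (θ z) : ℂ)) (𝓝[O] y) (𝓝 w)) :
    ∃ a, Tendsto θ (𝓝[O] y) (𝓝 a) := by
  have hw : ‖w‖ = 1 :=
    tendsto_nhds_unique h.norm (by simp)
  obtain ⟨b, hb⟩ : ∃ b : ℝ, (Circle.exp b : ℂ) = w := ⟨Complex.arg w, by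
    have := Complex.norm_mul_exp_arg_mul_I w
    rw [hw] at this
    simpa using this⟩
  let g : E → ℂ := fun z => (Circle.exp (θ z - b) : ℂ)
  have hg : Tendsto g (𝓝[O] y) (𝓝 1) := by
    have := h.div_const w
    rw [div_self (by rw [← norm_ne_zero_iff, hw]; exact one_ne_zero)] at this
    refine this.congr fun z => ?_
    simp only [g, Circle.exp_sub, Circle.coe_div, hb]
  have hs : ∀ᶠ z in 𝓝[O] y, g z ∈ Complex.slitPlane :=
    hg.eventually (Complex.isOpen_slitPlane.mem_nhds Complex.one_mem_slitPlane)
  obtain ⟨δ, hδ, hδs⟩ := Metric.mem_nhdsWithin_iff.1 hs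
  let S := Metric.ball y (min δ ε) ∩ O
  have hS : IsPreconnected S := ((convex_ball y _).inter hO).isPreconnected
  have hSm : S ∈ 𝓝[O] y :=
    inter_mem (mem_nhdsWithin_of_mem_nhds (Metric.ball_mem_nhds y (lt_min hδ hε)))
      self_mem_nhdsWithin
  obtain ⟨z₀, hz₀⟩ := nonempty_of_mem hSm
  have hexp : ∀ z, Circle.exp (θ z - b) = Circle.exp (Complex.arg (g z)) := fun z =>
    (Circle.exp_arg _).symm
  obtain ⟨m, hm⟩ := Circle.exp_eq_exp.1 (hexp z₀)
  have hθS : ContinuousOn θ S := hθ.mono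
    (Set.inter_subset_inter_left _ (Metric.ball_subset_ball (min_le_right _ _)))
  have heq := Circle.isCoveringMap_exp.eqOn_of_comp_eqOn hS
    (g₁ := fun z => θ z - b) (g₂ := fun z => Complex.arg (g z) + m * (2 * Real.pi))
    (hθS.sub continuousOn_const) ?_ ?_ hz₀ hm
  · refine ⟨Complex.arg 1 + m * (2 * Real.pi) + b, ?_⟩
    have h1 : Tendsto (fun z => Complex.arg (g z) + m * (2 * Real.pi) + b) (𝓝[O] y)
        (𝓝 (Complex.arg 1 + m * (2 * Real.pi) + b)) :=
      (((Complex.continuousAt_arg Complex.one_mem_slitPlane).tendsto.comp hg).add_const _).add_const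
        _
    refine h1.congr' ?_
    filter_upwards [hSm] with z hz
    have := heq hz
    dsimp only at this
    rw [← this]
    ring
  · refine ContinuousOn.add (fun z hz => ?_) continuousOn_const
    have hzs : g z ∈ Complex.slitPlane :=
      hδs ⟨Metric.ball_subset_ball (min_le_left _ _) hz.1, hz.2⟩
    refine (Complex.continuousAt_arg hzs).comp_continuousWithinAt (f := g) ?_
    have : Continuous fun t : ℝ => (Circle.exp (t - b) : ℂ) := by fun_prop
    exact this.continuousAt.comp_continuousWithinAt (hθS z hz)
  · intro z _
    simp only [Function.comp_apply]
    rw [hexp z]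
    exact (Circle.exp_eq_exp.2 ⟨m, rfl⟩).symm

end Log

section LinearAlgebra
variable {k : ℕ}

/-- The derivative of the character with exponent vector `χ`, as a linear form on the Lie algebra
`ℝ^k` of the torus. -/
noncomputable def charDeriv : (Fin k → ℤ) →+ ((Fin k → ℝ) →ₗ[ℝ] ℝ) where
  toFun χ := ∑ i, (χ i : ℝ) • LinearMap.proj i
  map_zero' := by simp
  map_add' χ ψ := by simp [add_smul, Finset.sum_add_distrib]

theorem charDeriv_apply (χ : Fin k → ℤ) (v : Fin k → ℝ) : charDeriv χ v = ∑ i, χ i * v i := by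
  simp [charDeriv]

theorem continuous_charDeriv (χ : Fin k → ℤ) : Continuous (charDeriv χ) :=
  LinearMap.continuous_of_finiteDimensional _

theorem torusChar_torusExp_eq (χ : Fin k → ℤ) (v : Fin k → ℝ) :
    torusChar χ (torusExp v) = Circle.exp (charDeriv χ v) := by
  rw [torusChar_torusExp, charDeriv_apply]

theorem exists_dual_vectors {ι : Type*} [DecidableEq ι] {e : ι → Fin k → ℤ}
    (he : LinearIndependent ℤ e) :
    ∃ v : ι → Fin k → ℝ, ∀ i j, charDeriv (e j) (v i) = if j = i then 1 else 0 := by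
  let c : (Fin k → ℤ) →ₗ[ℤ] (Fin k → ℚ) :=
    { toFun := fun χ i => χ i
      map_add' := fun χ ψ => by funext i; simp
      map_smul' := fun n χ => by funext i; simp }
  have hc : LinearMap.ker c = ⊥ := by
    rw [LinearMap.ker_eq_bot]
    intro χ ψ h
    funext i
    have hi : (χ i : ℚ) = ψ i := congrFun h i
    exact_mod_cast hi
  have hq : LinearIndependent ℚ (c ∘ e) :=
    (LinearIndependent.iff_fractionRing ℤ ℚ).1 (he.map' c hc)
  have hf : ∀ i, ∃ f : (Fin k → ℚ) →ₗ[ℚ] ℚ, ∀ j, f (c (e j)) = if j = i then 1 else 0 := by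
    intro i
    obtain ⟨f, hf⟩ := LinearMap.exists_extend
      ((Finsupp.lapply i).comp hq.repr)
    refine ⟨f, fun j => ?_⟩
    have h1 := LinearMap.congr_fun hf ⟨c (e j), Submodule.subset_span ⟨j, rfl⟩⟩
    have h2 := hq.repr_eq_single j ⟨c (e j), Submodule.subset_span ⟨j, rfl⟩⟩ rfl
    simp only [LinearMap.comp_apply, Submodule.subtype_apply, h2,
      Finsupp.lapply_apply, Finsupp.single_apply] at h1
    exact h1
  choose f hf using hf
  refine ⟨fun i m => (f i (Pi.single m 1) : ℝ), fun i j => ?_⟩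
  have h : ∑ m, (e j m : ℚ) * f i (Pi.single m 1) = if j = i then 1 else 0 := by
    rw [← hf i j, (f i).pi_apply_eq_sum_univ]
    refine Finset.sum_congr rfl fun m _ => ?_
    simp only [c, LinearMap.coe_mk, AddHom.coe_mk, smul_eq_mul]
    congr 2
    funext l
    simp [Pi.single_apply, eq_comm]
  rw [charDeriv_apply]
  have h' := congrArg (Rat.cast : ℚ → ℝ) h
  push_cast at h'
  refine h'.trans ?_
  split_ifs <;> simp

/-- A sublattice of full rank has finite index, so it contains a multiple of every element. -/
theorem exists_zsmul_mem_of_finrank_eq {K K' : Submodule ℤ (Fin k → ℤ)} (hK : K ≤ K')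
    (h : Module.finrank ℤ K = Module.finrank ℤ K') {χ : Fin k → ℤ} (hχ : χ ∈ K') :
    ∃ m : ℤ, m ≠ 0 ∧ m • χ ∈ K := by
  let N : Submodule ℤ K' := K.comap K'.subtype
  have hN : Module.finrank ℤ N = Module.finrank ℤ K' := by
    rw [← h]
    exact (Submodule.comapSubtypeEquivOfLe hK).finrank_eq
  have hfin : Finite (K' ⧸ N) := Submodule.finiteQuotientOfFreeOfRankEq N hN
  refine ⟨(Nat.card (K' ⧸ N) : ℤ), by exact_mod_cast Nat.card_pos.ne', ?_⟩
  have := AddSubgroup.nsmul_index_mem N.toAddSubgroup ⟨χ, hχ⟩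
  rw [natCast_zsmul]
  exact this

end LinearAlgebra

/-! ### Convergence of sections at the boundary -/

section Converge
variable {k : ℕ} {M : Type*} [TopologicalSpace M] [MulAction (Torus k) M]
  {E : Type*} [NormedAddCommGroup E] {D O : Set E} {q : M → D}

theorem IsOpenOrbitMap.nhdsWithin_le_map (hq : IsOpenOrbitMap (Torus k) q) (hOD : O ⊆ D) (x : M) :
    𝓝[O] (q x : E) ≤ map (fun x => (q x : E)) (𝓝 x) := by
  refine (nhdsWithin_mono _ hOD).trans ?_
  have h : map Subtype.val (map q (𝓝 x)) = map (fun x => (q x : E)) (𝓝 x) := map_map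
  rw [← h, ← map_nhds_subtype_val (q x)]
  exact map_mono (hq.isOpenMap.nhds_le x)

/-- An invariant function that is continuous at `x` converges along every section over `O`. -/
theorem IsOpenOrbitMap.tendsto_invariant (hq : IsOpenOrbitMap (Torus k) q) (hOD : O ⊆ D) {x : M}
    {u : M → ℂ} (hu : IsWeightFun (1 : Torus k →* Circle) u) (hc : ContinuousAt u x) {f : E → M}
    (hf : ∀ z ∈ O, (q (f z) : E) = z) :
    Tendsto (fun z => u (f z)) (𝓝[O] (q x : E)) (𝓝 (u x)) := by
  refine tendsto_comp_of_factorsThrough (p := fun x => (q x : E)) (hq.nhdsWithin_le_map hOD x)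
    (fun a b hab => hq.factorsThrough hu (Subtype.ext hab)) hc ?_
  filter_upwards [self_mem_nhdsWithin] with z hz using hf z hz

theorem IsOpenOrbitMap.exists_ball_ne_zero (hq : IsOpenOrbitMap (Torus k) q) {x : M} {φ : M → ℂ}
    (hφ : Continuous φ) {χ : Torus k →* Circle} (hw : IsWeightFun χ φ) (hx : φ x ≠ 0) :
    ∃ ε > 0, ∀ x', (q x' : E) ∈ Metric.ball (q x : E) ε → φ x' ≠ 0 := by
  have hV : IsOpen (q '' {y | φ y ≠ 0}) := hq.isOpenMap _ (isOpen_ne_fun hφ continuous_const)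
  obtain ⟨ε, hε, h⟩ := Metric.isOpen_iff.1 hV (q x) ⟨x, hx, rfl⟩
  refine ⟨ε, hε, fun x' hx' => ?_⟩
  obtain ⟨x'', h1, h2⟩ := h (show q x' ∈ Metric.ball (q x) ε from hx')
  obtain ⟨g, rfl⟩ := (hq.eq_iff _ _).1 h2
  exact (hw.ne_zero_smul g x'').2 h1

theorem eq_of_tendsto_orbitMap (hq : IsOpenOrbitMap (Torus k) q) {l : Filter E} [l.NeBot]
    {f : E → M} {x y : M} (hl : l ≤ 𝓝 (q x : E)) (hf : ∀ᶠ z in l, (q (f z) : E) = z)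
    (h : Tendsto f l (𝓝 y)) : q y = q x := by
  have h1 : Tendsto (fun z => (q (f z) : E)) l (𝓝 (q y : E)) :=
    ((continuous_subtype_val.comp hq.continuous).tendsto y).comp h
  have h2 : Tendsto (fun z => (q (f z) : E)) l (𝓝 (q x : E)) :=
    (tendsto_id.mono_left hl).congr' (hf.mono fun z hz => hz.symm)
  exact Subtype.ext (tendsto_nhds_unique h1 h2)

theorem eq_of_clusterPt_of_tendsto {α X Y : Type*} [TopologicalSpace X] [TopologicalSpace Y]
    [T2Space Y] {l : Filter α} {f : α → X} {u : X → Y} {y : X} {c : Y} (hu : Continuous u)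
    (hc : Tendsto (fun z => u (f z)) l (𝓝 c)) (hy : ClusterPt y (map f l)) : u y = c := by
  have h1 : ClusterPt (u y) (map u (map f l)) := hy.map hu.continuousAt tendsto_map
  have h2 : map u (map f l) ≤ 𝓝 c := hc
  exact eq_of_nhds_neBot (h1.mono h2)

variable [T2Space M] [CompactSpace M] [ContinuousSMul (Torus k) M]

/-- A section `f` converges at the orbit of `x` as soon as `φ ∘ f` converges for every weight
function `φ` with `φ x ≠ 0`: any two cluster points of `f` lie in this orbit, and weight functions
separate its points. -/
theorem exists_tendsto_of_forall_weightFun (hq : IsOpenOrbitMap (Torus k) q) {l : Filter E}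
    [l.NeBot] {f : E → M} {x : M} (hl : l ≤ 𝓝 (q x : E)) (hf : ∀ᶠ z in l, (q (f z) : E) = z)
    (h : ∀ (χ : Fin k → ℤ) (φ : M → ℂ), Continuous φ → IsWeightFun (torusChar χ) φ → φ x ≠ 0 →
      ∃ c, Tendsto (fun z => φ (f z)) l (𝓝 c)) :
    ∃ y, Tendsto f l (𝓝 y) := by
  have hqc : Continuous fun x => (q x : E) := continuous_subtype_val.comp hq.continuous
  have hqf : Tendsto (fun z => (q (f z) : E)) l (𝓝 (q x : E)) :=
    (tendsto_id.mono_left hl).congr' (hf.mono fun z hz => hz.symm)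
  obtain ⟨y, hy⟩ := exists_clusterPt_of_compactSpace (map f l)
  refine ⟨y, le_nhds_of_unique_clusterPt fun y' hy' => ?_⟩
  have e1 : q y = q x := Subtype.ext (eq_of_clusterPt_of_tendsto (u := fun x => (q x : E)) hqc hqf hy)
  have e2 : q y' = q x := Subtype.ext (eq_of_clusterPt_of_tendsto (u := fun x => (q x : E)) hqc hqf hy')
  obtain ⟨g, rfl⟩ := (hq.eq_iff y y').1 (e1.trans e2.symm)
  by_contra hne
  obtain ⟨χ, φ, hφc, hφ, hφy, hφg⟩ := exists_weightFun_ne hne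
  have hφx : φ x ≠ 0 := by
    obtain ⟨g', rfl⟩ := (hq.eq_iff y x).1 e1
    exact (hφ.ne_zero_smul g' y).2 hφy
  obtain ⟨c, hc⟩ := h χ φ hφc hφ hφx
  exact hφg ((eq_of_clusterPt_of_tendsto hφc hc hy').trans (eq_of_clusterPt_of_tendsto hφc hc hy).symm)

variable [NormedSpace ℝ E]

/-- The section `z ↦ torusExp (F z) • s₀ z` over `O`, which is the section `s₀` twisted by `F`, has a
limit at `y`. -/
def TwistConvergesAt (O : Set E) (s₀ : E → M) (F : E → Fin k → ℝ) (y : E) : Prop :=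
  ∃ x, Tendsto (fun z => torusExp (F z) • s₀ z) (𝓝[O] y) (𝓝 x)

/-- Twists that converge locally glue to one that converges globally. Near `x` the glued twist
`F' = ∑ ρ i • F i` differs from one of the `F i` by functions whose pairings with the weight lattice
of `x` converge: for the difference of two convergent twists, the exponential of the pairing
converges, hence the pairing itself does. -/
theorem exists_twist_of_local (hq : IsOpenOrbitMap (Torus k) q) (hO : IsOpen O)
    (hOc : Convex ℝ O) (hDO : D ⊆ closure O) {s₀ : E → M} (hs₀ : ∀ z ∈ O, (q (s₀ z) : E) = z)
    {ι : Type*} (U : ι → Set E) (hU : ∀ i, IsOpen (U i)) (hOU : O ⊆ ⋃ i, U i)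
    (F : ι → E → Fin k → ℝ) (hF : ∀ i, ContinuousOn (F i) (U i ∩ O))
    (hconv : ∀ i x, (q x : E) ∈ U i → TwistConvergesAt O s₀ (F i) (q x)) :
    ∃ F' : E → Fin k → ℝ, ContinuousOn F' O ∧
      ∀ x, (q x : E) ∈ ⋃ i, U i → TwistConvergesAt O s₀ F' (q x) := by
  obtain ⟨ρ, hρ⟩ := exists_partitionOfUnity_of_isOpen U hU
  have hsum : ∀ {t : Finset ι} {z : E}, (∀ i ∉ t, ρ i z = 0) →
      ∑ᶠ i, ρ i z • F i z = ∑ i ∈ t, ρ i z • F i z := by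
    intro t z h
    refine finsum_eq_sum_of_support_subset _ fun i hi => ?_
    by_contra hit
    exact hi (by simp [h i hit])
  refine ⟨fun z => ∑ᶠ i, ρ i z • F i z, fun y hy => ?_, fun x hx => ?_⟩
  · obtain ⟨hc, t, htU, ht⟩ := hρ y (hOU hy)
    refine ContinuousAt.continuousWithinAt ?_
    have h : ContinuousAt (fun z => ∑ i ∈ t, ρ i z • F i z) y := by
      refine tendsto_finsetSum _ fun i hi => (hc i).smul ?_
      exact (hF i).continuousAt (((hU i).inter hO).mem_nhds ⟨htU i hi, hy⟩)
    exact h.congr (ht.mono fun z hz => (hsum hz.2).symm)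
  · obtain ⟨hc, t, htU, ht⟩ := hρ _ hx
    have hne : (𝓝[O] (q x : E)).NeBot := mem_closure_iff_nhdsWithin_neBot.1 (hDO (q x).2)
    obtain ⟨i₀, hi₀⟩ : t.Nonempty := by
      rw [Finset.nonempty_iff_ne_empty]
      rintro rfl
      simpa using ht.self_of_nhds.1
    have htw : ∀ (F : E → Fin k → ℝ), ∀ᶠ z in 𝓝[O] (q x : E),
        (q (torusExp (F z) • s₀ z) : E) = z := fun F => by
      filter_upwards [self_mem_nhdsWithin] with z hz
      rw [hq.apply_smul, hs₀ z hz]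
    have hφne : ∀ {χ : Fin k → ℤ} {φ : M → ℂ}, IsWeightFun (torusChar χ) φ → φ x ≠ 0 →
        ∀ {y : M}, q y = q x → φ y ≠ 0 := by
      intro χ φ hφ hφx y hy
      obtain ⟨g, rfl⟩ := (hq.eq_iff x y).1 hy.symm
      exact (hφ.ne_zero_smul g x).2 hφx
    refine exists_tendsto_of_forall_weightFun hq nhdsWithin_le_nhds (htw _)
      fun χ φ hφc hφ hφx => ?_
    have hlim : ∀ i ∈ t, ∃ c, c ≠ 0 ∧
        Tendsto (fun z => φ (torusExp (F i z) • s₀ z)) (𝓝[O] (q x : E)) (𝓝 c) := by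
      intro i hi
      obtain ⟨y, hy⟩ := hconv i x (htU i hi)
      exact ⟨φ y, hφne hφ hφx (eq_of_tendsto_orbitMap hq nhdsWithin_le_nhds (htw _) hy),
        (hφc.tendsto y).comp hy⟩
    obtain ⟨c₀, hc₀, hlim₀⟩ := hlim i₀ hi₀
    have hev := hlim₀.eventually_ne hc₀
    have hdiff : ∀ (F' : E → Fin k → ℝ) z, φ (torusExp (F' z) • s₀ z) =
        (Circle.exp (charDeriv χ (F' z) - charDeriv χ (F i₀ z)) : ℂ) *
          φ (torusExp (F i₀ z) • s₀ z) := by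
      intro F' z
      rw [hφ, hφ, torusChar_torusExp_eq, torusChar_torusExp_eq, ← mul_assoc, ← Circle.coe_mul,
        ← Circle.exp_add, sub_add_cancel]
    have ha : ∀ i ∈ t, ∃ a, Tendsto (fun z => charDeriv χ (F i z) - charDeriv χ (F i₀ z))
        (𝓝[O] (q x : E)) (𝓝 a) := by
      intro i hi
      obtain ⟨c, -, hci⟩ := hlim i hi
      obtain ⟨ε, hε, hεU⟩ := Metric.isOpen_iff.1 ((hU i).inter (hU i₀)) _ ⟨htU i hi, htU i₀ hi₀⟩
      refine exists_tendsto_of_tendsto_circleExp hOc hε (w := c / c₀) ?_ ?_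
      · refine ((continuous_charDeriv χ).comp_continuousOn ((hF i).mono ?_)).sub
          ((continuous_charDeriv χ).comp_continuousOn ((hF i₀).mono ?_))
        · exact Set.inter_subset_inter_left _ fun z hz => (hεU hz).1
        · exact Set.inter_subset_inter_left _ fun z hz => (hεU hz).2
      · refine (hci.div hlim₀ hc₀).congr' ?_
        filter_upwards [hev] with z hz
        rw [Pi.div_apply, hdiff (F i) z, mul_div_cancel_right₀ _ hz]
    choose! a ha using ha
    have h1 : Tendsto (fun z => ∑ i ∈ t, ρ i z * (charDeriv χ (F i z) - charDeriv χ (F i₀ z)))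
        (𝓝[O] (q x : E)) (𝓝 (∑ i ∈ t, ρ i (q x) * a i)) :=
      tendsto_finsetSum _ fun i hi => ((hc i).mono_left nhdsWithin_le_nhds).mul (ha i hi)
    have hexp : Continuous fun r : ℝ => (Circle.exp r : ℂ) := by fun_prop
    refine ⟨_, (((hexp.tendsto _).comp h1).mul hlim₀).congr' ?_⟩
    filter_upwards [nhdsWithin_le_nhds ht] with z hz
    refine Eq.trans ?_ (hdiff (fun z => ∑ᶠ i, ρ i z • F i z) z).symm
    rw [Function.comp_apply, hsum hz.2]
    congr 3
    simp only [map_sum, map_smul, smul_eq_mul, mul_sub, Finset.sum_sub_distrib, ← Finset.sum_mul,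
      hz.1, one_mul]

/-- If the twist by `F` converges at all orbits whose weight lattice has larger rank than that of `x`,
then near `x` it can be corrected so as to converge at all orbits. For a basis `e i` of the weight
lattice of `x`, the correction, in the directions dual to the `e i`, makes the weight functions
`φ i` of weight `e i` positive along the twisted section. The correction converges at the nearby
orbits where `F` converges already. At the nearby orbits of the same rank, every weight has a
multiple that is a combination of the `e i`, so all weight functions converge. -/
theorem exists_local_twist (hq : IsOpenOrbitMap (Torus k) q) (hOD : O ⊆ D) (hO : IsOpen O)
    (hOc : Convex ℝ O) (hDO : D ⊆ closure O) {s₀ : E → M} (hs₀ : ∀ z ∈ O, (q (s₀ z) : E) = z)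
    (hs₀c : ContinuousOn s₀ O) {x : M} {F : E → Fin k → ℝ} (hF : ContinuousOn F O)
    (hconv : ∀ x', Module.finrank ℤ (weightLattice k x) < Module.finrank ℤ (weightLattice k x') →
      TwistConvergesAt O s₀ F (q x')) :
    ∃ U, IsOpen U ∧ (q x : E) ∈ U ∧ ∃ F' : E → Fin k → ℝ, ContinuousOn F' (U ∩ O) ∧
      ∀ x', (q x' : E) ∈ U → TwistConvergesAt O s₀ F' (q x') := by
  classical
  let b := Module.Free.chooseBasis ℤ (weightLattice k x)
  let e : Module.Free.ChooseBasisIndex ℤ (weightLattice k x) → Fin k → ℤ := fun i => b i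
  have he : LinearIndependent ℤ e :=
    b.linearIndependent.map' (weightLattice k x).subtype (Submodule.ker_subtype _)
  obtain ⟨v, hv⟩ := exists_dual_vectors he
  have hφ : ∀ i, ∃ f : M → ℂ, Continuous f ∧ IsWeightFun (torusChar (e i)) f ∧ f x ≠ 0 :=
    fun i => (b i).2
  choose φ hφc hφ hφx using hφ
  -- Branches along `s₀` of the argument of a weight function.
  have hlog : ∀ {χ : Fin k → ℤ} {f : M → ℂ} {x' : M}, Continuous f → IsWeightFun (torusChar χ) f →
      ∀ {ε : ℝ}, (∀ x'', (q x'' : E) ∈ Metric.ball (q x' : E) ε → f x'' ≠ 0) →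
      ∃ θ : E → ℝ, ContinuousOn θ (Metric.ball (q x' : E) ε ∩ O) ∧
        ∀ z ∈ Metric.ball (q x' : E) ε ∩ O, f (s₀ z) / ‖f (s₀ z)‖ = Circle.exp (θ z) := by
    intro χ f x' hfc hf ε hε
    refine exists_continuousOn_circleExp_eq (Metric.isOpen_ball.inter hO)
      ((convex_ball _ _).inter hOc)
      (hfc.comp_continuousOn (hs₀c.mono Set.inter_subset_right)) fun z hz => hε _ ?_
    rw [hs₀ z hz.2]
    exact hz.1
  obtain ⟨ε, hε, hball⟩ := hq.exists_ball_ne_zero (x := x)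
    (φ := fun y => ∏ i, φ i y) (continuous_finsetProd _ fun i _ => hφc i)
    (IsWeightFun.prod Finset.univ fun i _ => hφ i) (Finset.prod_ne_zero_iff.2 fun i _ => hφx i)
  have hball' : ∀ i x', (q x' : E) ∈ Metric.ball (q x : E) ε → φ i x' ≠ 0 := fun i x' hx' =>
    Finset.prod_ne_zero_iff.1 (hball x' hx') i (Finset.mem_univ i)
  have hθ := fun i => hlog (hφc i) (hφ i) (hball' i)
  choose θ hθc hθ using hθ
  let F' : E → Fin k → ℝ := fun z => F z - ∑ i, (θ i z + charDeriv (e i) (F z)) • v i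
  have hF'e : ∀ i z, charDeriv (e i) (F' z) = -θ i z := fun i z => by
    simp [F', map_sub, map_sum, hv]
  have hF'c : ContinuousOn F' (Metric.ball (q x : E) ε ∩ O) := by
    have hF1 := hF.mono (Set.inter_subset_right (s := Metric.ball (q x : E) ε))
    refine hF1.sub (continuousOn_finsetSum _ fun i _ => ?_)
    have h1 : ContinuousOn (fun z => θ i z + charDeriv (e i) (F z)) _ :=
      (hθc i).add ((continuous_charDeriv _).comp_continuousOn hF1)
    exact h1.smul continuousOn_const
  refine ⟨_, Metric.isOpen_ball, Metric.mem_ball_self hε, F', hF'c, fun x' hx' => ?_⟩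
  have hne : (𝓝[O] (q x' : E)).NeBot := mem_closure_iff_nhdsWithin_neBot.1 (hDO (q x').2)
  obtain ⟨δ, hδ, hδb⟩ := Metric.isOpen_iff.1 Metric.isOpen_ball _ hx'
  have hUev : ∀ᶠ z in 𝓝[O] (q x' : E), z ∈ Metric.ball (q x : E) ε ∩ O :=
    inter_mem (mem_nhdsWithin_of_mem_nhds (Metric.isOpen_ball.mem_nhds hx')) self_mem_nhdsWithin
  have htw : ∀ (F : E → Fin k → ℝ), ∀ᶠ z in 𝓝[O] (q x' : E),
      (q (torusExp (F z) • s₀ z) : E) = z := fun F => by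
    filter_upwards [self_mem_nhdsWithin] with z hz
    rw [hq.apply_smul, hs₀ z hz]
  have hle : weightLattice k x ≤ weightLattice k x' := by
    intro χ hχ
    have h1 : (∑ i, b.repr ⟨χ, hχ⟩ i • e i) = χ := by
      have := congrArg (weightLattice k x).subtype (b.sum_repr ⟨χ, hχ⟩)
      rwa [map_sum] at this
    rw [← h1]
    exact sum_mem fun i _ => Submodule.smul_mem _ _ ⟨φ i, hφc i, hφ i, hball' i x' hx'⟩
  rcases (Submodule.finrank_mono hle).lt_or_eq with hlt | heq
  · obtain ⟨y, hy⟩ := hconv x' hlt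
    have hqy := eq_of_tendsto_orbitMap hq nhdsWithin_le_nhds (htw F) hy
    have ha : ∀ i, ∃ a, Tendsto (fun z => θ i z + charDeriv (e i) (F z)) (𝓝[O] (q x' : E))
        (𝓝 a) := by
      intro i
      have hφy : φ i y ≠ 0 := hball' i y (by rw [hqy]; exact hx')
      refine exists_tendsto_of_tendsto_circleExp hOc hδ (w := φ i y / ‖φ i y‖) ?_ ?_
      · have h1 : Metric.ball (q x' : E) δ ∩ O ⊆ Metric.ball (q x : E) ε ∩ O :=
          Set.inter_subset_inter_left _ hδb
        exact ((hθc i).mono h1).add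
          ((continuous_charDeriv _).comp_continuousOn (hF.mono Set.inter_subset_right))
      · have h2 : ContinuousAt (fun y => φ i y / (‖φ i y‖ : ℂ)) y :=
          (hφc i).continuousAt.div (by fun_prop) (by simpa using hφy)
        refine (h2.tendsto.comp hy).congr' ?_
        filter_upwards [hUev] with z hz
        refine ((hφ i).div_norm (torusExp (F z)) (s₀ z)).trans ?_
        change _ * (φ i (s₀ z) / (‖φ i (s₀ z)‖ : ℂ)) = _
        rw [hθ i z hz, torusChar_torusExp_eq,
          ← Circle.coe_mul, ← Circle.exp_add, add_comm]
    choose a ha using ha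
    have hsum : Tendsto (fun z => -∑ i, (θ i z + charDeriv (e i) (F z)) • v i) (𝓝[O] (q x' : E))
        (𝓝 (-∑ i, a i • v i)) :=
      (tendsto_finsetSum _ fun i _ => (ha i).smul_const (v i)).neg
    refine ⟨_, (((continuous_torusExp.tendsto _).comp hsum).smul hy).congr fun z => ?_⟩
    rw [Function.comp_apply, smul_smul, ← torusExp_add]
    congr 2
    simp only [F']
    abel
  · refine exists_tendsto_of_forall_weightFun hq nhdsWithin_le_nhds (htw _)
      fun χ f hfc hf hfx => ?_
    obtain ⟨m, hm0, hm⟩ := exists_zsmul_mem_of_finrank_eq hle heq ⟨f, hfc, hf, hfx⟩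
    let n := b.repr ⟨m • χ, hm⟩
    have hn : ∑ i, n i • e i = m • χ := by
      have := congrArg (weightLattice k x).subtype (b.sum_repr ⟨m • χ, hm⟩)
      rwa [map_sum] at this
    obtain ⟨η₀, hη₀, hη₀b⟩ := hq.exists_ball_ne_zero hfc hf hfx
    let η := min η₀ δ
    have hη : 0 < η := lt_min hη₀ hδ
    have hηb : ∀ x'', (q x'' : E) ∈ Metric.ball (q x' : E) η → f x'' ≠ 0 := fun x'' h =>
      hη₀b x'' (Metric.ball_subset_ball (min_le_left _ _) h)
    have hηε : Metric.ball (q x' : E) η ∩ O ⊆ Metric.ball (q x : E) ε ∩ O :=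
      Set.inter_subset_inter_left _ ((Metric.ball_subset_ball (min_le_right _ _)).trans hδb)
    obtain ⟨ψ, hψc, hψ⟩ := hlog hfc hf hηb
    have hηev : ∀ᶠ z in 𝓝[O] (q x' : E), z ∈ Metric.ball (q x' : E) η ∩ O :=
      inter_mem (mem_nhdsWithin_of_mem_nhds (Metric.ball_mem_nhds _ hη)) self_mem_nhdsWithin
    -- A product of weight functions of total weight `m χ - ∑ n i e i = 0`, hence invariant; along `s₀`
    -- it is the exponential of `m ψ - ∑ n i θ i`.
    let u : M → ℂ := fun y => (f y / ‖f y‖) ^ m * ∏ i, (φ i y / ‖φ i y‖) ^ (-n i)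
    have hu : IsWeightFun (1 : Torus k →* Circle) u := by
      have h1 : torusChar χ ^ m * ∏ i, torusChar (e i) ^ (-n i) = 1 := by
        simp only [← torusChar_zsmul, ← torusChar_sum, ← torusChar_add, neg_smul,
          Finset.sum_neg_distrib, hn, add_neg_cancel, torusChar_zero]
      rw [← h1]
      exact (hf.div_norm.zpow m).mul (IsWeightFun.prod _ fun i _ => (hφ i).div_norm.zpow _)
    have hunit : ∀ {g : M → ℂ} {y : M} (j : ℤ), Continuous g → g y ≠ 0 →
        ContinuousAt (fun y => (g y / (‖g y‖ : ℂ)) ^ j) y := fun {g y} j hg hy => by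
      have h1 : (‖g y‖ : ℂ) ≠ 0 := by simpa using hy
      exact (hg.continuousAt.div (by fun_prop) h1).zpow₀ j (Or.inl (div_ne_zero hy h1))
    have huc : ContinuousAt u x' :=
      (hunit m hfc hfx).mul (tendsto_finsetProd _ fun i _ => hunit _ (hφc i) (hball' i x' hx'))
    have hexpz : ∀ (r : ℝ) (j : ℤ), (Circle.exp r : ℂ) ^ j = Circle.exp (j * r) := fun r j => by
      rw [Circle.exp_intCast_mul, Circle.coe_zpow]
    have hexps : ∀ r : Module.Free.ChooseBasisIndex ℤ (weightLattice k x) → ℝ,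
        ∏ i, (Circle.exp (r i) : ℂ) = Circle.exp (∑ i, r i) := fun r => by
      simp only [Circle.coe_exp, ← Complex.exp_sum, Complex.ofReal_sum, Finset.sum_mul]
    have hlim : Tendsto (fun z => (Circle.exp (m * ψ z + ∑ i, (-n i : ℤ) * θ i z) : ℂ))
        (𝓝[O] (q x' : E)) (𝓝 (u x')) := by
      refine (hq.tendsto_invariant hOD hu huc hs₀).congr' ?_
      filter_upwards [hηev] with z hz
      simp only [u, hψ z hz, hθ _ z (hηε hz), hexpz, hexps, ← Circle.coe_mul, ← Circle.exp_add]
    have hcont : ContinuousOn (fun z => m * ψ z + ∑ i, (-n i : ℤ) * θ i z)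
        (Metric.ball (q x' : E) η ∩ O) :=
      (continuousOn_const.mul hψc).add (continuousOn_finsetSum _ fun i _ =>
        continuousOn_const.mul ((hθc i).mono hηε))
    obtain ⟨a, ha⟩ := exists_tendsto_of_tendsto_circleExp hOc hη hcont hlim
    have hnorm : Tendsto (fun z => ((‖f (s₀ z)‖ : ℝ) : ℂ)) (𝓝[O] (q x' : E)) (𝓝 (‖f x'‖ : ℂ)) :=
      hq.tendsto_invariant hOD hf.norm (by fun_prop) hs₀
    have hexp : Continuous fun r : ℝ => (Circle.exp r : ℂ) := by fun_prop
    refine ⟨_, (((hexp.tendsto _).comp (ha.div_const (m : ℝ))).mul hnorm).congr' ?_⟩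
    filter_upwards [hηev] with z hz
    have hm0' : (m : ℝ) ≠ 0 := by exact_mod_cast hm0
    have h1 : (m : ℝ) * charDeriv χ (F' z) = ∑ i, (-n i : ℤ) * θ i z := by
      have h2 := congrArg (fun ξ => charDeriv ξ (F' z)) hn
      simp only [map_sum, map_zsmul, LinearMap.sum_apply, LinearMap.smul_apply, hF'e] at h2
      simp only [zsmul_eq_mul] at h2
      rw [← h2]
      refine Finset.sum_congr rfl fun i _ => ?_
      push_cast
      ring
    have hfz : f (s₀ z) ≠ 0 := hηb _ (by rw [hs₀ z hz.2]; exact hz.1)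
    have h3 : f (s₀ z) = Circle.exp (ψ z) * (‖f (s₀ z)‖ : ℂ) := by
      rw [← hψ z hz, div_mul_cancel₀]
      simpa using hfz
    rw [hf, torusChar_torusExp_eq]
    conv_rhs => rw [h3]
    rw [← mul_assoc, ← Circle.coe_mul, ← Circle.exp_add, Function.comp_apply, ← h1]
    congr 3
    field_simp
    ring

end Converge

/-! ### Construction of the section -/

section Section
variable {k : ℕ} {M : Type*} [TopologicalSpace M] [MulAction (Torus k) M]
  {E : Type*} [NormedAddCommGroup E] {D O : Set E} {q : M → D}

/-- The union of the orbits over `O`, as a space with torus action. -/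
def orbitPreimage (hq : IsOpenOrbitMap (Torus k) q) (O : Set E) : SubMulAction (Torus k) M where
  carrier := {x | (q x : E) ∈ O}
  smul_mem' := by
    intro g x hx
    change (q (g • x) : E) ∈ O
    rw [hq.apply_smul]
    exact hx

theorem IsOpenOrbitMap.restrict (hq : IsOpenOrbitMap (Torus k) q) (hOD : O ⊆ D) (hO : IsOpen O) :
    IsOpenOrbitMap (Torus k) fun x : orbitPreimage hq O => (⟨q x.1, x.2⟩ : O) where
  continuous := Continuous.subtype_mk
    (continuous_subtype_val.comp (hq.continuous.comp continuous_subtype_val)) _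
  isOpenMap := by
    intro V hV
    have hX : IsOpen {x : M | (q x : E) ∈ O} :=
      hO.preimage (continuous_subtype_val.comp hq.continuous)
    have h1 : IsOpen (q '' (Subtype.val '' V)) :=
      hq.isOpenMap _ (hX.isOpenMap_subtype_val V hV)
    convert h1.preimage (continuous_inclusion hOD) using 1
    ext z
    constructor
    · rintro ⟨x, hx, rfl⟩
      exact ⟨x.1, ⟨x, hx, rfl⟩, rfl⟩
    · rintro ⟨_, ⟨x, hx, rfl⟩, h⟩
      exact ⟨x, hx, Subtype.ext (congrArg (Subtype.val : D → E) h)⟩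
  surjective := by
    intro z
    obtain ⟨x, hx⟩ := hq.surjective ⟨z, hOD z.2⟩
    have hx' : (q x : E) = z := congrArg Subtype.val hx
    exact ⟨⟨x, by change (q x : E) ∈ O; rw [hx']; exact z.2⟩, Subtype.ext hx'⟩
  eq_iff := by
    intro x y
    have h := hq.eq_iff x.1 y.1
    rw [Subtype.ext_iff, ← Subtype.ext_iff (a1 := q x.1) (a2 := q y.1), h]
    exact exists_congr fun g => by rw [Subtype.ext_iff]; rfl

theorem IsOpenOrbitMap.homeomorph_comp {G X B B' : Type*} [Group G] [MulAction G X]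
    [TopologicalSpace X] [TopologicalSpace B] [TopologicalSpace B'] {P : X → B}
    (hP : IsOpenOrbitMap G P) (h : B ≃ₜ B') : IsOpenOrbitMap G (fun x => h (P x)) where
  continuous := h.continuous.comp hP.continuous
  isOpenMap := h.isOpenMap.comp hP.isOpenMap
  surjective := h.surjective.comp hP.surjective
  eq_iff x y := by rw [h.injective.eq_iff, hP.eq_iff]

variable [T2Space M] [CompactSpace M] [ContinuousSMul (Torus k) M]

/-- If all orbits over `O ≅ ℝ^d` have the same weight lattice, there is a section over `O`. For a
basis `e i` of the lattice, take nowhere vanishing weight functions `Ψ i` of absolute value one; the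
points where all `Ψ i` equal `1` form one point in each orbit. -/
theorem exists_continuousOn_section {ι : Type*} [Fintype ι] (hq : IsOpenOrbitMap (Torus k) q)
    (hOD : O ⊆ D) (hO : IsOpen O) (h : O ≃ₜ (ι → ℝ)) {L : Submodule ℤ (Fin k → ℤ)}
    (hL : ∀ x, (q x : E) ∈ O → weightLattice k x = L) :
    ∃ s₀ : E → M, ContinuousOn s₀ O ∧ ∀ z ∈ O, (q (s₀ z) : E) = z := by
  classical
  let X := orbitPreimage hq O
  have hr := hq.restrict hOD hO
  let p : X → E := fun x => q x.1
  have hpo : IsOpenMap p := hO.isOpenMap_subtype_val.comp hr.isOpenMap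
  have hps : ∀ z ∈ O, ∃ x : X, p x = z := fun z hz => by
    obtain ⟨x, hx⟩ := hr.surjective ⟨z, hz⟩
    exact ⟨x, congrArg Subtype.val hx⟩
  have hpe : ∀ x y : X, p x = p y → ∃ g : Torus k, g • x = y := fun x y hxy =>
    (hr.eq_iff x y).1 (Subtype.ext hxy)
  let b := Module.Free.chooseBasis ℤ L
  let e : Module.Free.ChooseBasisIndex ℤ L → Fin k → ℤ := fun i => b i
  have he : LinearIndependent ℤ e := b.linearIndependent.map' L.subtype (Submodule.ker_subtype _)
  obtain ⟨v, hv⟩ := exists_dual_vectors he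
  have hΦ : ∀ i, ∃ Φ : X → ℂ, Continuous Φ ∧ IsWeightFun (torusChar (e i)) Φ ∧ ∀ x, Φ x ≠ 0 := by
    intro i
    refine exists_continuous_weightFun_ne_zero (hr.homeomorph_comp h) fun x => ?_
    have hi : e i ∈ weightLattice k x.1 := by
      rw [hL x.1 x.2]
      exact (b i).2
    obtain ⟨f, hfc, hf, hfx⟩ := hi
    exact ⟨fun y => f y.1, hfc.comp continuous_subtype_val, fun g y => hf g y.1, hfx⟩
  choose Φ hΦc hΦ hΦ0 using hΦ
  let Ψ : Module.Free.ChooseBasisIndex ℤ L → X → ℂ := fun i x => Φ i x / ‖Φ i x‖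
  have hΨ : ∀ i, IsWeightFun (torusChar (e i)) (Ψ i) := fun i => (hΦ i).div_norm
  have hΨ0 : ∀ i x, Ψ i x ≠ 0 := fun i x => div_ne_zero (hΦ0 i x) (by simpa using hΦ0 i x)
  have hΨc : ∀ i, Continuous (Ψ i) := fun i =>
    (hΦc i).div (by have := hΦc i; fun_prop) fun x => by simpa using hΦ0 i x
  have hsec : ∀ z, ∃ x : X, z ∈ O → p x = z ∧ ∀ i, Ψ i x = 1 := by
    intro z
    by_cases hz : z ∈ O
    · obtain ⟨x, hx⟩ := hps z hz
      let w : Fin k → ℝ := -∑ i, Complex.arg (Φ i x) • v i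
      refine ⟨torusExp w • x, fun _ => ⟨?_, fun i => ?_⟩⟩
      · rw [← hx]
        exact congrArg Subtype.val (hq.apply_smul _ x.1)
      · have hw : charDeriv (e i) w = -Complex.arg (Φ i x) := by
          simp [w, map_sum, hv]
        have h1 : Ψ i x = Circle.exp (Complex.arg (Φ i x)) := by
          have h2 := Complex.norm_mul_exp_arg_mul_I (Φ i x)
          have h3 : (‖Φ i x‖ : ℂ) ≠ 0 := by simpa using hΦ0 i x
          simp only [Ψ, Circle.coe_exp]
          rw [div_eq_iff h3, mul_comm]
          exact h2.symm
        rw [hΨ, h1, torusChar_torusExp_eq, hw, ← Circle.coe_mul, ← Circle.exp_add,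
          neg_add_cancel, Circle.exp_zero, Circle.coe_one]
    · have : Nonempty X := (hr.homeomorph_comp h).surjective.nonempty
      exact ⟨Classical.arbitrary X, fun h => absurd h hz⟩
  choose s hs using hsec
  refine ⟨fun z => s z, fun y hy => ContinuousAt.continuousWithinAt ?_, fun z hz => (hs z hz).1⟩
  have hev : ∀ᶠ z in 𝓝 y, z ∈ O := hO.mem_nhds hy
  have hqy : (q (s y).1 : E) = y := (hs y hy).1
  suffices hlim : ∃ x, Tendsto (fun z => (s z).1) (𝓝 y) (𝓝 x) by
    obtain ⟨x, hx⟩ := hlim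
    exact continuousAt_of_tendsto_nhds hx
  refine exists_tendsto_of_forall_weightFun hq (x := (s y).1) (by rw [hqy])
    (hev.mono fun z hz => (hs z hz).1) fun χ f hfc hf hfx => ?_
  have hχ : χ ∈ L := by
    rw [← hL (s y).1 (s y).2]
    exact ⟨f, hfc, hf, hfx⟩
  let n := b.repr ⟨χ, hχ⟩
  have hn : ∑ i, n i • e i = χ := by
    have := congrArg L.subtype (b.sum_repr ⟨χ, hχ⟩)
    rwa [map_sum] at this
  let u : X → ℂ := fun x => f x.1 * ∏ i, Ψ i x ^ (-n i)
  have hfX : IsWeightFun (torusChar χ) fun x : X => f x.1 := fun g x => hf g x.1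
  have hu : IsWeightFun (1 : Torus k →* Circle) u := by
    have h1 : torusChar χ * ∏ i, torusChar (e i) ^ (-n i) = 1 := by
      simp only [← torusChar_zsmul, ← torusChar_sum, ← torusChar_add, neg_smul,
        Finset.sum_neg_distrib, hn, add_neg_cancel, torusChar_zero]
    rw [← h1]
    exact hfX.mul (IsWeightFun.prod _ fun i _ => (hΨ i).zpow _)
  have huc : Continuous u := (hfc.comp continuous_subtype_val).mul
    (continuous_finsetProd _ fun i _ => (hΨc i).zpow₀ _ fun x => Or.inl (hΨ0 i x))
  have hup : Function.FactorsThrough u p := fun x x' hxx' => by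
    obtain ⟨g, rfl⟩ := hpe x x' hxx'
    simp [hu g x]
  have hl : 𝓝 y ≤ map p (𝓝 (s y)) := by
    have := hpo.nhds_le (s y)
    rwa [show p (s y) = y from hqy] at this
  refine ⟨_, (tendsto_comp_of_factorsThrough hl hup (huc.tendsto _)
    (hev.mono fun z hz => (hs z hz).1)).congr' ?_⟩
  filter_upwards [hev] with z hz
  simp only [u, (hs z hz).2, one_zpow, Finset.prod_const_one, mul_one]

variable [NormedSpace ℝ E]

/-- A section over `O` can be twisted so that it converges at all points of `D`. Convergence is
achieved at the orbits whose weight lattice has rank `≥ j`, by decreasing induction on `j`. -/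
theorem exists_twistConvergesAt (hq : IsOpenOrbitMap (Torus k) q) (hOD : O ⊆ D) (hO : IsOpen O)
    (hOc : Convex ℝ O) (hDO : D ⊆ closure O) {s₀ : E → M} (hs₀ : ∀ z ∈ O, (q (s₀ z) : E) = z)
    (hs₀c : ContinuousOn s₀ O) :
    ∃ F : E → Fin k → ℝ, ContinuousOn F O ∧ ∀ x, TwistConvergesAt O s₀ F (q x) := by
  have key : ∀ n : ℕ, ∃ F : E → Fin k → ℝ, ContinuousOn F O ∧
      ∀ x, k < Module.finrank ℤ (weightLattice k x) + n → TwistConvergesAt O s₀ F (q x) := by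
    intro n
    induction n with
    | zero =>
      refine ⟨0, continuousOn_const, fun x hx => ?_⟩
      have := (weightLattice k x).finrank_le
      rw [Module.finrank_fin_fun] at this
      omega
    | succ n ih =>
      obtain ⟨F, hF, hFt⟩ := ih
      have hloc : ∀ x : {x : M // (q x : E) ∈ O ∨
          k < Module.finrank ℤ (weightLattice k x) + (n + 1)}, ∃ U, IsOpen U ∧ (q x : E) ∈ U ∧
          ∃ F' : E → Fin k → ℝ, ContinuousOn F' (U ∩ O) ∧
            ∀ x', (q x' : E) ∈ U → TwistConvergesAt O s₀ F' (q x') := by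
        rintro ⟨x, hx | hx⟩
        · refine ⟨O, hO, hx, F, hF.mono Set.inter_subset_right, fun x' hx' => ?_⟩
          exact ⟨_, ((continuous_torusExp.continuousAt.comp_continuousWithinAt (hF _ hx')).smul
            (hs₀c _ hx')).tendsto⟩
        · exact exists_local_twist hq hOD hO hOc hDO hs₀ hs₀c hF fun x' hx' =>
            hFt x' (by dsimp only at hx'; omega)
      choose U hU hxU F' hF' hF't using hloc
      obtain ⟨F'', hF'', ht⟩ := exists_twist_of_local hq hO hOc hDO hs₀ U hU (fun z hz => by
        obtain ⟨x, hx⟩ := hq.surjective ⟨z, hOD hz⟩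
        have hx' : (q x : E) = z := congrArg Subtype.val hx
        have hxO : (q x : E) ∈ O := by rwa [hx']
        have htr : ∀ V : Set E, (q x : E) ∈ V → z ∈ V := fun V hV => by rwa [hx'] at hV
        exact Set.mem_iUnion.2 ⟨⟨x, Or.inl hxO⟩, htr _ (hxU ⟨x, Or.inl hxO⟩)⟩) F' hF' hF't
      exact ⟨F'', hF'', fun x hx => ht x (Set.mem_iUnion.2 ⟨⟨x, Or.inr hx⟩, hxU _⟩)⟩
  obtain ⟨F, hF, hFt⟩ := key (k + 1)
  exact ⟨F, hF, fun x => hFt x (by omega)⟩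

/-- A torus action whose orbit space is a set `D` in a normed space has a global section, if `D` is
the closure of an open convex set over which the isotropy group is constant. -/
theorem exists_continuous_section {ι : Type*} [Fintype ι] (hq : IsOpenOrbitMap (Torus k) q)
    (hOD : O ⊆ D) (hO : IsOpen O) (hOc : Convex ℝ O) (hDO : D ⊆ closure O) (h : O ≃ₜ (ι → ℝ))
    {H : Subgroup (Torus k)}
    (hH : ∀ x, (q x : E) ∈ O → MulAction.stabilizer (Torus k) x = H) :
    ∃ s : C(D, M), ∀ z, q (s z) = z := by
  obtain ⟨z₀, hz₀⟩ : O.Nonempty := ⟨_, (h.symm 0).2⟩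
  obtain ⟨x₀, hx₀⟩ := hq.surjective ⟨z₀, hOD hz₀⟩
  have hL : ∀ x, (q x : E) ∈ O → weightLattice k x = weightLattice k x₀ := by
    intro x hx
    have hx₀' : (q x₀ : E) ∈ O := by rw [hx₀]; exact hz₀
    ext χ
    rw [mem_weightLattice_iff_stabilizer, mem_weightLattice_iff_stabilizer, hH x hx, hH x₀ hx₀']
  obtain ⟨s₀, hs₀c, hs₀⟩ := exists_continuousOn_section hq hOD hO h hL
  obtain ⟨F, -, hF⟩ := exists_twistConvergesAt hq hOD hO hOc hDO hs₀ hs₀c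
  let f : E → M := fun z => torusExp (F z) • s₀ z
  have hlim : ∀ z : D, ∃ x, Tendsto f (𝓝[O] (z : E)) (𝓝 x) := fun z => by
    obtain ⟨x, rfl⟩ := hq.surjective z
    exact hF x
  have hc : ContinuousOn (extendFrom O f) D :=
    continuousOn_extendFrom hDO fun z hz => hlim ⟨z, hz⟩
  refine ⟨⟨fun z => extendFrom O f z, hc.domRestrict⟩, fun z => ?_⟩
  have hne : (𝓝[O] (z : E)).NeBot := mem_closure_iff_nhdsWithin_neBot.1 (hDO z.2)
  obtain ⟨x, rfl⟩ := hq.surjective z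
  refine eq_of_tendsto_orbitMap hq nhdsWithin_le_nhds ?_ (tendsto_extendFrom (hlim (q x)))
  filter_upwards [self_mem_nhdsWithin] with z hz
  rw [hq.apply_smul, hs₀ z hz]

end Section

/-! ### The orbit map -/

section Orbit

theorem isOpenOrbitMap_orbitMap (G M : Type*) [Group G] [MulAction G M] [TopologicalSpace M]
    [ContinuousConstSMul G M] : IsOpenOrbitMap G (orbitMap G : M → OrbitSpace G M) where
  continuous := continuous_quot_mk
  isOpenMap := isOpenMap_quotient_mk'_mul
  surjective := Quotient.mk_surjective
  eq_iff x y := by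
    rw [eq_comm]
    exact Quotient.eq.trans (MulAction.orbitRel_apply.trans Iff.rfl)

/-- Principal orbits of an abelian group have the same isotropy group, not only conjugate ones. -/
theorem stabilizer_eq_of_isPrincipalOrbit {G M : Type*} [CommGroup G] [MulAction G M] {x y : M}
    (hx : IsPrincipalOrbit G x) (hy : IsPrincipalOrbit G y) :
    MulAction.stabilizer G x = MulAction.stabilizer G y := by
  have key : ∀ {x : M}, IsPrincipalOrbit G x → ∀ y : M, MulAction.stabilizer G x ≤
      MulAction.stabilizer G y := by
    intro x hx y
    obtain ⟨g, hg⟩ := hx y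
    refine le_trans (fun h hh => ?_) hg
    rw [MulAction.mem_stabilizer_iff] at hh ⊢
    rw [smul_smul, mul_comm, mul_smul, hh]
  exact le_antisymm (key hx y) (key hy x)

end Orbit

theorem theoremt (n k : ℕ) (hkn : k ≤ n)
    (M : Type*) [TopologicalSpace M] [T2Space M] [CompactSpace M]
    [ChartedSpace (EuclideanSpace ℝ (Fin n)) M] [IsManifold (𝓡 n) ∞ M]
    [MulAction (Torus k) M]
    [ContMDiffSMul (ModelWithCorners.pi fun _ : Fin k => 𝓡 1) (𝓡 n) ∞ (Torus k) M]
    (φ : OrbitSpace (Torus k) M ≃ₜ Disk (n - k))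
    (hint : ∀ x : M, ‖(φ (orbitMap (Torus k) x) : EuclideanSpace ℝ (Fin (n - k)))‖ < 1 →
      IsPrincipalOrbit (Torus k) x)
    (hbd : ∀ x : M, ‖(φ (orbitMap (Torus k) x) : EuclideanSpace ℝ (Fin (n - k)))‖ = 1 →
      IsSingularOrbit k x ∧ IsConnected (MulAction.stabilizer (Torus k) x : Set (Torus k))) :
    ∃ s : C(OrbitSpace (Torus k) M, M), ∀ q, orbitMap (Torus k) (s q) = q := by
  have : ContinuousSMul (Torus k) M :=
    ContMDiffSMul.continuousSMul (I := ModelWithCorners.pi fun _ : Fin k => 𝓡 1) (I' := 𝓡 n) ∞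
  have hq := (isOpenOrbitMap_orbitMap (Torus k) M).homeomorph_comp φ
  have h : Metric.ball (0 : EuclideanSpace ℝ (Fin (n - k))) 1 ≃ₜ (Fin (n - k) → ℝ) :=
    Homeomorph.unitBall.symm.trans (EuclideanSpace.equiv (Fin (n - k)) ℝ).toHomeomorph
  obtain ⟨x₀, hx₀⟩ := hq.surjective ⟨0, by simp⟩
  obtain ⟨s, hs⟩ := exists_continuous_section hq Metric.ball_subset_closedBall Metric.isOpen_ball
    (convex_ball _ _) (closure_ball _ one_ne_zero).ge h
    (H := MulAction.stabilizer (Torus k) x₀) fun x hx =>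
      stabilizer_eq_of_isPrincipalOrbit (hint x (by simpa using hx)) (hint x₀ (by simp [hx₀]))
  exact ⟨s.comp ⟨φ, φ.continuous⟩, fun y => φ.injective (hs (φ y))⟩
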